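/- \textbf{Corollary (Mehta's integral formula for $p$-fields).} Let $K$ be a $p$-field (a nonarchimedean local field) with ring of integers $R$ and residue field of cardinality $q$. Let $\mu$ be the Haar measure on $(K,+)$ with $\mu(R)=1$, let $|x|=\mu(xR)/\mu(R)$ be the canonical absolute value, and for $N\ge 2$ put $\|x\|=\max_i|x_i|$ on $K^N$ and write $|dx|$ for $\mu^N$. Let $\rho$ be a complex-valued function on $\mathcal N=\{0\}\cup\bigcup_{n\ge1}\{n,\tfrac1n\}$ (or on a larger subset of $\mathbb R$; only its values on $\mathcal N$ matter) such that $$\limsup_{n\to\infty}\frac{\log|\rho(1/n)|}{\log n}\le 1,\qquad \limsup_{n\to\infty}\frac{\log|\rho(n)|}{\log n}=-\infty\qquad(\log 0:=-\infty),$$ and put $$H_q^\rho(z)=\frac{1-q^{-z}}{1-q^{-(z-1)}}\sum_{m\in\mathbb Z}\rho(q^m)q^{mz}.$$ A \emph{splitting filtration} of order $N$ is a tuple $S=(\pi_0,\dots,\pi_L)$ of partitions of $[N]=\{1,\dots,N\}$ with $\{[N]\}=\pi_0>\pi_1>\dots>\pi_L=\{\{1\},\dots,\{N\}\}$, where $\pi'<\pi$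 means that $\pi'$ is a proper refinement of $\pi$. Its set of \emph{branches} $\mathcal B(S)$ consists of the blocks $\lambda$ of $\pi_0,\dots,\pi_{L-1}$ with $\#\lambda>1$. $S$ is \emph{reduced} if every branch lies in exactly one of $\pi_0,\dots,\pi_{L-1}$. Let $\mathcal S_N$ and $\mathcal R_N$ be the sets of all, respectively all reduced, splitting filtrations of order $N$. For $\lambda\in\mathcal B(S)$ let $\ell_S(\lambda)$ be the largest $\ell\le L-1$ with $\lambda\in\pi_\ell$, and let $\deg_S(\lambda)$ be the number of blocks of $\pi_{\ell_S(\lambda)+1}$ contained in $\lambda$. Put $M_{S,q}=\prod_{\lambda\in\mathcal B(S)}(q-1)_{\deg_S(\lambda)-1}$, with falling factorials $(n)_k=n(n-1)\cdots(n-k+1)$, and, for $\boldsymbol s=(s_{ij})_{i<j}$, $$e_\lambda(\boldsymbol s)=\#\lambda-1+\sum_{\substack{i<j\\ i,j\in\lambda}}s_{ij},\qquad I_{S,q}(\boldsymbol s)=\frac{M_{S,q}}{q^{N-1}}\prod_{\lambda\in\mathcal B(S)\setminus\{[N]\}}\frac1{q^{e_\lambda(\boldsymbol s)}-1}.$$ (a)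 Let $q_1,\dots,q_N>0$ and $\boldsymbol c=(q_iq_j)_{i<j}$. If $\beta\in\mathbb C$ satisfies $$\operatorname{Re}(\beta)>-\inf_{\substack{S\in\mathcal R_N\\ M_{S,q}>0}}\ \inf_{\lambda\in\mathcal B(S)}\ \frac{\#\lambda-1}{\sum_{i<j,\ i,j\in\lambda}q_iq_j},$$ then the integral and the series over $m\in\mathbb{Z}$ that defines $H_q^\rho$ below converge absolutely, and $$\mathcal Z_N(\beta):=\int_{K^N}\rho(\|x\|)\prod_{i<j}|x_i-x_j|^{q_iq_j\beta}\,|dx|=H_q^\rho\Big(N+\sum_{i<j}q_iq_j\beta\Big)\cdot\sum_{\substack{S\in\mathcal R_N\\ M_{S,q}>0}}I_{S,q}(\beta\boldsymbol c).$$ (b) In particular, if $q_1=\dots=q_N=1$ and $\operatorname{Re}(\beta)>-\frac2N$, then, for every full set $\mathcal C_N\subset\mathcal S_N$ of orbit representatives for the natural action of $\operatorname{Sym}([N])$ on $\mathcal S_N$, and with $W(S)$ the cardinality of the orbit of $S$, the integral and the series over $m\in\mathbb{Z}$ below converge absolutely, and $$\mathcal Z_N(\beta)=\frac{1-q^{-\binom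 N2\left(\beta+\frac2{N-1}\right)}}{1-q^{-\binom N2\left(\beta+\frac2N\right)}}\cdot\sum_{m\in\mathbb Z}\rho(q^m)q^{m\binom N2\left(\beta+\frac2{N-1}\right)}\cdot\sum_{\substack{S\in\mathcal C_N\cap\mathcal R_N\\ M_{S,q}>0}}\frac{W(S)M_{S,q}}{q^{N-1}}\prod_{\lambda\in\mathcal B(S)\setminus\{[N]\}}\frac1{q^{\binom{\#\lambda}2\left(\beta+\frac2{\#\lambda}\right)}-1}.$$ -/

import Mathlib

open MeasureTheory Filter Finset
open scoped ENNReal ValuativeRel Pointwise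

namespace PField

/-! ### Splitting filtrations of `[N] = Fin N` -/

/-- The strictly decreasing tuples `(⊓_0 > ⊓_1 > ⋯ > ⊓_L)` of partitions of `[N]` (ordered by
refinement) that start at the one-block partition and end at the partition into singletons. -/
@[ext]
structure SplittingFiltration (N : ℕ) where
  /-- the length `L` -/
  length : ℕ
  /-- the partitions `⊓_0, …, ⊓_L` -/
  level : Fin (length + 1) → Finpartition (univ : Finset (Fin N))
  level_zero : (level 0).parts = {univ}
  level_last : (level (Fin.last length)).parts = univ.image fun i => {i}
  strictAnti : StrictAnti level

namespace SplittingFiltration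

variable {N : ℕ}

instance instFinite : Finite (SplittingFiltration N) := by
  let P := Finpartition (univ : Finset (Fin N))
  let f : SplittingFiltration N →
      (Σ L : Fin (Fintype.card P), (Fin ((L : ℕ) + 1) → P)) := fun S =>
    ⟨⟨S.length, by
      have h := Fintype.card_le_of_injective S.level S.strictAnti.injective
      rw [Fintype.card_fin] at h
      exact h⟩, S.level⟩
  refine Finite.of_injective f ?_
  rintro ⟨L, l, _, _, _⟩ ⟨L', l', _, _, _⟩ h
  simp only [f, Sigma.mk.injEq, Fin.mk.injEq] at h
  obtain ⟨rfl, h⟩ := h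
  simp only [heq_eq_eq] at h
  subst h
  rfl

noncomputable instance instFintype : Fintype (SplittingFiltration N) := Fintype.ofFinite _

/-- The branches: blocks with more than one element of the partitions `⊓_0, …, ⊓_{L-1}`. -/
def branches (S : SplittingFiltration N) : Finset (Finset (Fin N)) :=
  univ.filter fun B => 1 < #B ∧ ∃ l : Fin S.length, B ∈ (S.level l.castSucc).parts

/-- Every branch lies in exactly one of the partitions `⊓_0, …, ⊓_{L-1}`. -/
def IsReduced (S : SplittingFiltration N) : Prop :=
  ∀ B ∈ S.branches, ∃! l : Fin S.length, B ∈ (S.level l.castSucc).parts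

noncomputable instance instDecidableIsReduced :
    DecidablePred (IsReduced : SplittingFiltration N → Prop) := Classical.decPred _

/-- The largest `l ∈ {0, …, L-1}` with `B ∈ ⊓_l` (used for branches `B` only). -/
def depth (S : SplittingFiltration N) (B : Finset (Fin N)) : ℕ :=
  (univ.filter fun l : Fin S.length => B ∈ (S.level l.castSucc).parts).sup fun l => (l : ℕ)

/-- The partition `⊓_n`; the index is capped at `L`, which changes nothing for `n ≤ L`. -/
def levelAt (S : SplittingFiltration N) (n : ℕ) : Finpartition (univ : Finset (Fin N)) :=
  S.level ⟨min n S.length, by omega⟩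

/-- The number of blocks of `⊓_{depth B + 1}` contained in the branch `B`. -/
def degree (S : SplittingFiltration N) (B : Finset (Fin N)) : ℕ :=
  #((S.levelAt (S.depth B + 1)).parts.filter fun B' => B' ⊆ B)

/-- The multiplicity `∏ (q-1)_{deg B - 1}` over the branches `B`, with falling factorials. -/
def multiplicity (S : SplittingFiltration N) (q : ℕ) : ℕ :=
  ∏ B ∈ S.branches, (q - 1).descFactorial (S.degree B - 1)

end SplittingFiltration

/-- The pairs `i < j` of elements of `B`. -/
def pairs {N : ℕ} (B : Finset (Fin N)) : Finset (Fin N × Fin N) :=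
  (B ×ˢ B).filter fun p => p.1 < p.2

/-- The branch exponent `e_B(s) = (#B - 1) + ∑_{i<j in B} s_{ij}`. Only the entries `s i j` with
`i < j` matter. -/
noncomputable def branchExponent {N : ℕ} (B : Finset (Fin N)) (s : Fin N → Fin N → ℂ) : ℂ :=
  ((#B : ℂ) - 1) + ∑ p ∈ pairs B, s p.1 p.2

/-- The branch function `I_{S,q}(s)`; the product is over the branches other than `[N]`. -/
noncomputable def branchFunction {N : ℕ} (S : SplittingFiltration N) (q : ℕ)
    (s : Fin N → Fin N → ℂ) : ℂ :=
  (S.multiplicity q : ℂ) / (q : ℂ) ^ (N - 1) *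
    ∏ B ∈ S.branches.erase univ, 1 / ((q : ℂ) ^ branchExponent B s - 1)

/-- The reduced splitting filtrations of order `N` whose multiplicity is positive. -/
noncomputable def admissible (N q : ℕ) : Finset (SplittingFiltration N) :=
  univ.filter fun S => S.IsReduced ∧ 0 < S.multiplicity q

/-- `- inf_S inf_B (#B - 1) / ∑_{i<j in B} q_i q_j`, over admissible `S` and all branches `B` of
`S`, the branch `[N]` included. -/
noncomputable def mehtaAbscissa {N : ℕ} (q : ℕ) (charge : Fin N → ℝ) : ℝ :=
  -⨅ S : {S : SplittingFiltration N // S ∈ admissible N q},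
    ⨅ B : {B : Finset (Fin N) // B ∈ S.1.branches},
      ((#B.1 : ℝ) - 1) / ∑ p ∈ pairs B.1, charge p.1 * charge p.2

/-! ### The action of the symmetric group -/

/-- The partition `{σ(B) : B ∈ P}`. -/
def permPartition {N : ℕ} (σ : Equiv.Perm (Fin N)) (P : Finpartition (univ : Finset (Fin N))) :
    Finpartition (univ : Finset (Fin N)) :=
  Finpartition.ofExistsUnique (P.parts.image fun B => B.image σ)
    (fun _ _ => subset_univ _)
    (by
      intro a _
      obtain ⟨B, ⟨hB, haB⟩, huniq⟩ := P.existsUnique_mem (mem_univ (σ.symm a))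
      refine ⟨B.image σ, ⟨mem_image_of_mem _ hB, ?_⟩, ?_⟩
      · exact mem_image.2 ⟨σ.symm a, haB, by simp⟩
      · rintro t ⟨ht, hat⟩
        obtain ⟨B', hB', rfl⟩ := mem_image.1 ht
        obtain ⟨i, hi, rfl⟩ := mem_image.1 hat
        have : B' = B := huniq B' ⟨hB', by simpa using hi⟩
        rw [this])
    (by
      intro h
      obtain ⟨B, hB, hB0⟩ := mem_image.1 h
      rw [image_eq_empty] at hB0
      exact P.bot_notMem (by rw [hB0] at hB; exact hB))

theorem permPartition_parts {N : ℕ} (σ : Equiv.Perm (Fin N))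
    (P : Finpartition (univ : Finset (Fin N))) :
    (permPartition σ P).parts = P.parts.image fun B => B.image σ := rfl

theorem permPartition_one {N : ℕ} (P : Finpartition (univ : Finset (Fin N))) :
    permPartition 1 P = P := by
  ext B
  simp [permPartition_parts]

theorem permPartition_mul {N : ℕ} (σ τ : Equiv.Perm (Fin N))
    (P : Finpartition (univ : Finset (Fin N))) :
    permPartition (σ * τ) P = permPartition σ (permPartition τ P) := by
  ext B
  simp [permPartition_parts, image_image, Function.comp_def]

theorem permPartition_mono {N : ℕ} (σ : Equiv.Perm (Fin N)) :
    Monotone (permPartition (N := N) σ) := by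
  intro P Q h B hB
  obtain ⟨A, hA, rfl⟩ := mem_image.1 hB
  obtain ⟨C, hC, hAC⟩ := h hA
  exact ⟨C.image σ, mem_image_of_mem _ hC, image_subset_image hAC⟩

theorem permPartition_injective {N : ℕ} (σ : Equiv.Perm (Fin N)) :
    Function.Injective (permPartition (N := N) σ) := by
  intro P Q h
  have := congrArg (permPartition σ⁻¹) h
  simpa only [← permPartition_mul, inv_mul_cancel, permPartition_one] using this

/-- `σ` acts on a splitting filtration by `(⊓_0, …, ⊓_L) ↦ (σ(⊓_0), …, σ(⊓_L))`. -/
instance {N : ℕ} : SMul (Equiv.Perm (Fin N)) (SplittingFiltration N) where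
  smul σ S :=
    { length := S.length
      level := fun l => permPartition σ (S.level l)
      level_zero := by
        rw [permPartition_parts, S.level_zero, image_singleton,
          image_univ_of_surjective σ.surjective]
      level_last := by
        rw [permPartition_parts, S.level_last, image_image]
        ext B
        simp only [mem_image, mem_univ, true_and, Function.comp_apply, image_singleton]
        exact ⟨fun ⟨i, hi⟩ => ⟨σ i, hi⟩, fun ⟨i, hi⟩ => ⟨σ.symm i, by simpa using hi⟩⟩
      strictAnti := fun _ _ h =>
        ((permPartition_mono σ).strictMono_of_injective (permPartition_injective σ))
          (S.strictAnti h) }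

instance {N : ℕ} : MulAction (Equiv.Perm (Fin N)) (SplittingFiltration N) where
  one_smul _ := SplittingFiltration.ext rfl (heq_of_eq (funext fun _ => permPartition_one _))
  mul_smul σ τ _ :=
    SplittingFiltration.ext rfl (heq_of_eq (funext fun _ => permPartition_mul σ τ _))

/-- The weight `W(S)`: the number of elements of the orbit of `S`. -/
noncomputable def weight {N : ℕ} (S : SplittingFiltration N) : ℕ :=
  (MulAction.orbit (Equiv.Perm (Fin N)) S).ncard

/-- `C` contains exactly one element of every orbit. -/
def IsOrbitTransversal {N : ℕ} (C : Finset (SplittingFiltration N)) : Prop :=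
  ∀ S : SplittingFiltration N, ∃! T, T ∈ C ∧ T ∈ MulAction.orbit (Equiv.Perm (Fin N)) S

/-! ### The background function and the root function -/

/-- `limsup log|ρ(1/n)| / log n ≤ 1` and `limsup log|ρ(n)| / log n = -∞`, with the extended
logarithm (`log 0 = -∞`). -/
def HasAdmissibleGrowth (ρ : ℝ → ℂ) : Prop :=
  limsup (fun n : ℕ => ENNReal.log ‖ρ (1 / (n : ℝ))‖ₑ / (Real.log n : EReal)) atTop ≤ 1 ∧
  limsup (fun n : ℕ => ENNReal.log ‖ρ (n : ℝ)‖ₑ / (Real.log n : EReal)) atTop = ⊥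

/-- The terms `ρ(q^m) q^{mz}`, `m ∈ ℤ`. -/
noncomputable def rootTerm (q : ℕ) (ρ : ℝ → ℂ) (z : ℂ) (m : ℤ) : ℂ :=
  ρ ((q : ℝ) ^ m) * (q : ℂ) ^ ((m : ℂ) * z)

/-- `H_q^ρ(z)`. -/
noncomputable def rootFunction (q : ℕ) (ρ : ℝ → ℂ) (z : ℂ) : ℂ :=
  (1 - (q : ℂ) ^ (-z)) / (1 - (q : ℂ) ^ (-(z - 1))) * ∑' m : ℤ, rootTerm q ρ z m

/-! ### Measure, absolute value and norm over a `p`-field -/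

section Field

variable (K : Type*) [Field K] [ValuativeRel K] [TopologicalSpace K]
  [IsNonarchimedeanLocalField K]

/-- The ring of integers as a compact set with nonempty interior. -/
def integersPositiveCompacts : TopologicalSpace.PositiveCompacts K where
  carrier := (𝒪[K] : Set K)
  isCompact' := IsNonarchimedeanLocalField.isCompact_closedBall K 1
  interior_nonempty' := by
    have h : IsOpen (𝒪[K] : Set K) := (ValuativeRel.valuation K).isOpen_integer
    rw [h.interior_eq]
    exact ⟨0, zero_mem _⟩

variable [MeasurableSpace K] [BorelSpace K]

/-- The Haar measure on `(K, +)` that gives the ring of integers mass `1`. -/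
noncomputable def normalizedHaar : Measure K :=
  Measure.addHaarMeasure (integersPositiveCompacts K)

variable {K}

/-- The canonical absolute value `|x| = μ(xR) / μ(R)`, the module of multiplication by `x`. -/
noncomputable def canonicalAbs (x : K) : ℝ :=
  (normalizedHaar K (x • (𝒪[K] : Set K))).toReal / (normalizedHaar K (𝒪[K] : Set K)).toReal

/-- The norm `max_i |x_i|` on `K^N`. -/
noncomputable def maxNorm {N : ℕ} (x : Fin N → K) : ℝ := ⨆ i, canonicalAbs (x i)

/-- `ρ(‖x‖) ∏_{i<j} |x_i - x_j|^{q_i q_j β}`. -/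
noncomputable def gasDensity {N : ℕ} (ρ : ℝ → ℂ) (charge : Fin N → ℝ) (β : ℂ)
    (x : Fin N → K) : ℂ :=
  ρ (maxNorm x) *
    ∏ p ∈ pairs (univ : Finset (Fin N)),
      ((canonicalAbs (x p.1 - x p.2) : ℝ) : ℂ) ^ (((charge p.1 * charge p.2 : ℝ) : ℂ) * β)

variable (K)

/-- The product measure `|dx| = μ^N` on `K^N`. -/
noncomputable def productHaar (N : ℕ) : Measure (Fin N → K) :=
  Measure.pi fun _ => normalizedHaar K

/-- The canonical partition function `Z_N(β)`. -/
noncomputable def partitionFunction {N : ℕ} (ρ : ℝ → ℂ) (charge : Fin N → ℝ) (β : ℂ) : ℂ :=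
  ∫ x : Fin N → K, gasDensity ρ charge β x ∂(productHaar K N)

end Field

end PField

open PField

namespace PField

section FieldBasics

variable {K : Type*} [Field K] [ValuativeRel K] [TopologicalSpace K]
  [IsNonarchimedeanLocalField K]

variable (K) in
theorem secondCountableTopology : SecondCountableTopology K := by
  let := IsTopologicalAddGroup.rightUniformSpace K
  have := isUniformAddGroup_of_addCommGroup (G := K)
  let : (Valued.v (R := K)).RankOne :=
  { hom' := ValuativeRel.IsRankLeOne.nonempty.some.emb (R := K).comp
      MonoidWithZeroHom.ValueGroup₀.embedding
    strictMono' := ValuativeRel.IsRankLeOne.nonempty.some.strictMono.comp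
        MonoidWithZeroHom.ValueGroup₀.embedding_strictMono }
  open scoped Valued in
  have : ProperSpace K := .of_nontriviallyNormedField_of_weaklyLocallyCompactSpace K
  open scoped Valued in
  exact secondCountable_of_proper

attribute [local instance] secondCountableTopology

variable (K) in
theorem t2Space : T2Space K := by
  let := IsTopologicalAddGroup.rightUniformSpace K
  have := isUniformAddGroup_of_addCommGroup (G := K)
  infer_instance

attribute [local instance] t2Space

variable (K) in
/-- A generator of the maximal ideal of the ring of integers. -/
noncomputable def integerUniformizer : 𝒪[K] :=
  (IsDiscreteValuationRing.exists_irreducible 𝒪[K]).choose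

variable (K) in
theorem irreducible_integerUniformizer : Irreducible (integerUniformizer K) :=
  (IsDiscreteValuationRing.exists_irreducible 𝒪[K]).choose_spec

variable (K) in
/-- The generator of the maximal ideal, as an element of the field. -/
noncomputable def uniformizer : K := (integerUniformizer K : K)

theorem uniformizer_mem : uniformizer K ∈ 𝒪[K] := (integerUniformizer K).2

theorem uniformizer_ne_zero : uniformizer K ≠ 0 := by
  have := (irreducible_integerUniformizer K).ne_zero
  simpa [uniformizer] using this

/-- The residue class, extended by zero outside of the ring of integers. -/
noncomputable def res (x : K) : 𝓀[K] :=
  open Classical in if h : x ∈ 𝒪[K] then IsLocalRing.residue 𝒪[K] ⟨x, h⟩ else 0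

/-- A representative of a residue class. -/
noncomputable def lift (a : 𝓀[K]) : K :=
  ((IsLocalRing.residue_surjective (R := 𝒪[K]) a).choose : 𝒪[K])

theorem lift_mem (a : 𝓀[K]) : lift a ∈ 𝒪[K] :=
  ((IsLocalRing.residue_surjective (R := 𝒪[K]) a).choose).2

theorem res_lift (a : 𝓀[K]) : res (lift a) = a := by
  rw [res, dif_pos (lift_mem a)]
  exact (IsLocalRing.residue_surjective (R := 𝒪[K]) a).choose_spec

theorem res_eq_iff {x y : K} (hx : x ∈ 𝒪[K]) (hy : y ∈ 𝒪[K]) :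
    res x = res y ↔ ∃ z ∈ 𝒪[K], x = y + uniformizer K * z := by
  rw [res, res, dif_pos hx, dif_pos hy, ← sub_eq_zero, ← map_sub, IsLocalRing.residue_eq_zero_iff,
    (IsDiscreteValuationRing.irreducible_iff_uniformizer _).1 (irreducible_integerUniformizer K),
    Ideal.mem_span_singleton]
  constructor
  · rintro ⟨z, hz⟩
    refine ⟨z, z.2, ?_⟩
    have := congrArg (Subtype.val) hz
    simp only [uniformizer]
    simp at this
    rw [← this]; ring
  · rintro ⟨z, hz, h⟩
    refine ⟨⟨z, hz⟩, Subtype.ext ?_⟩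
    simp [h, uniformizer]

/-- The points of the ring of integers with a prescribed residue class. -/
theorem integer_res_iff {x : K} {a : 𝓀[K]} :
    (x ∈ 𝒪[K] ∧ res x = a) ↔ ∃ z ∈ 𝒪[K], lift a + uniformizer K * z = x := by
  constructor
  · rintro ⟨hx, h⟩
    rw [← res_lift a, res_eq_iff hx (lift_mem a)] at h
    obtain ⟨z, hz, h⟩ := h
    exact ⟨z, hz, h.symm⟩
  · rintro ⟨z, hz, rfl⟩
    have hx : lift a + uniformizer K * z ∈ 𝒪[K] :=
      add_mem (lift_mem a) (mul_mem uniformizer_mem hz)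
    refine ⟨hx, ?_⟩
    conv_rhs => rw [← res_lift a]
    rw [res_eq_iff hx (lift_mem a)]
    exact ⟨z, hz, rfl⟩

theorem exists_unit_mul_zpow {x : K} (hx : x ≠ 0) :
    ∃ (u : 𝒪[K]ˣ) (m : ℤ), x = (u : 𝒪[K]) * uniformizer K ^ m := by
  have key : ∀ y : 𝒪[K], y ≠ 0 → ∃ (u : 𝒪[K]ˣ) (n : ℕ), (y : K) = (u : 𝒪[K]) * uniformizer K ^ n := by
    intro y hy
    obtain ⟨n, u, h⟩ := IsDiscreteValuationRing.eq_unit_mul_pow_irreducible hy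
      (irreducible_integerUniformizer K)
    exact ⟨u, n, by rw [h]; simp [uniformizer]⟩
  have hx' : x ∈ 𝒪[K] ∨ x⁻¹ ∈ 𝒪[K] := by
    rw [Valuation.mem_integer_iff, Valuation.mem_integer_iff, map_inv₀]
    rcases le_total ((ValuativeRel.valuation K) x) 1 with h | h
    · exact .inl h
    · exact .inr (inv_le_one_of_one_le₀ h)
  rcases hx' with h | h
  · obtain ⟨u, n, h⟩ := key ⟨x, h⟩ (by simpa [Subtype.ext_iff] using hx)
    exact ⟨u, n, by simpa using h⟩
  · obtain ⟨u, n, h⟩ := key ⟨x⁻¹, h⟩ (by simpa [Subtype.ext_iff] using hx)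
    refine ⟨u⁻¹, -n, ?_⟩
    have h' : x = (x⁻¹)⁻¹ := (inv_inv x).symm
    simp only at h
    rw [h', h, mul_inv, zpow_neg, zpow_natCast]
    congr 1
    have : ((u : 𝒪[K]) : K) * ((u⁻¹ : 𝒪[K]ˣ) : 𝒪[K]) = 1 := by
      rw [← Subring.coe_mul]; simp
    exact inv_eq_of_mul_eq_one_right this

variable (K) in
theorem one_lt_card_residue : 1 < Nat.card 𝓀[K] := Finite.one_lt_card

section Abs

variable [MeasurableSpace K] [BorelSpace K]

instance : (normalizedHaar K).IsAddHaarMeasure := by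
  unfold normalizedHaar; infer_instance

instance : (normalizedHaar K).Regular := by
  unfold normalizedHaar; infer_instance

theorem normalizedHaar_integer : normalizedHaar K (𝒪[K] : Set K) = 1 :=
  Measure.addHaarMeasure_self (K₀ := integersPositiveCompacts K)

theorem canonicalAbs_eq (x : K) :
    canonicalAbs x = (normalizedHaar K (x • (𝒪[K] : Set K))).toReal := by
  rw [canonicalAbs, normalizedHaar_integer]; simp

theorem canonicalAbs_nonneg (x : K) : 0 ≤ canonicalAbs x := by
  rw [canonicalAbs_eq]; exact ENNReal.toReal_nonneg

theorem canonicalAbs_units (c : Kˣ) : canonicalAbs (c : K) = distribHaarChar K c := by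
  have := distribHaarChar_mul (normalizedHaar K) c (𝒪[K] : Set K)
  rw [normalizedHaar_integer, mul_one] at this
  rw [canonicalAbs_eq]
  change (normalizedHaar K (c • (𝒪[K] : Set K))).toReal = _
  rw [← this]; simp

theorem normalizedHaar_smul {c : K} (hc : c ≠ 0) (s : Set K) :
    normalizedHaar K (c • s) = ENNReal.ofReal (canonicalAbs c) * normalizedHaar K s := by
  lift c to Kˣ using hc.isUnit
  have := distribHaarChar_mul (normalizedHaar K) c s
  rw [canonicalAbs_units, ENNReal.ofReal_coe_nnreal, this]
  rfl

theorem canonicalAbs_pos {c : K} (hc : c ≠ 0) : 0 < canonicalAbs c := by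
  lift c to Kˣ using hc.isUnit
  rw [canonicalAbs_units]
  exact_mod_cast distribHaarChar_pos

theorem canonicalAbs_mul_of_ne_zero {x y : K} (hx : x ≠ 0) (hy : y ≠ 0) :
    canonicalAbs (x * y) = canonicalAbs x * canonicalAbs y := by
  lift x to Kˣ using hx.isUnit
  lift y to Kˣ using hy.isUnit
  rw [← Units.val_mul, canonicalAbs_units, canonicalAbs_units, canonicalAbs_units, map_mul,
    NNReal.coe_mul]

theorem canonicalAbs_one : canonicalAbs (1 : K) = 1 := by
  rw [← Units.val_one, canonicalAbs_units, map_one, NNReal.coe_one]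

theorem measurableSet_integer : MeasurableSet (𝒪[K] : Set K) :=
  (ValuativeRel.valuation K).isOpen_integer.measurableSet

theorem canonicalAbs_uniformizer :
    canonicalAbs (uniformizer K) = (Nat.card 𝓀[K] : ℝ)⁻¹ := by
  classical
  have := Fintype.ofFinite 𝓀[K]
  have hU : (𝒪[K] : Set K) = ⋃ a : 𝓀[K], lift a +ᵥ uniformizer K • (𝒪[K] : Set K) := by
    ext x
    simp only [SetLike.mem_coe, Set.mem_iUnion, Set.mem_vadd_set, Set.mem_smul_set, vadd_eq_add,
      smul_eq_mul]
    constructor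
    · intro hx
      obtain ⟨z, hz, h⟩ := integer_res_iff.1 ⟨hx, rfl⟩
      exact ⟨res x, _, ⟨z, hz, rfl⟩, h⟩
    · rintro ⟨a, _, ⟨z, hz, rfl⟩, h⟩
      exact (integer_res_iff.2 ⟨z, hz, h⟩).1
  have hd : Pairwise (Function.onFun Disjoint
      fun a : 𝓀[K] => lift a +ᵥ uniformizer K • (𝒪[K] : Set K)) := by
    intro a b hab
    rw [Function.onFun, Set.disjoint_left]
    intro x hx hx'
    simp only [SetLike.mem_coe, Set.mem_vadd_set, Set.mem_smul_set, vadd_eq_add,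
      smul_eq_mul] at hx hx'
    obtain ⟨_, ⟨z, hz, rfl⟩, h⟩ := hx
    obtain ⟨_, ⟨z', hz', rfl⟩, h'⟩ := hx'
    exact hab ((integer_res_iff.2 ⟨z, hz, h⟩).2.symm.trans (integer_res_iff.2 ⟨z', hz', h'⟩).2)
  have hm : ∀ a : 𝓀[K], MeasurableSet (lift a +ᵥ uniformizer K • (𝒪[K] : Set K)) := fun a =>
    (measurableSet_integer.const_smul₀ _).const_vadd _
  have h1 := normalizedHaar_integer (K := K)
  rw [hU, measure_iUnion hd hm] at h1
  simp only [measure_vadd, normalizedHaar_smul uniformizer_ne_zero, normalizedHaar_integer,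
    mul_one, tsum_fintype, sum_const, card_univ, nsmul_eq_mul] at h1
  have h2 := congrArg ENNReal.toReal h1
  rw [ENNReal.toReal_mul, ENNReal.toReal_ofReal (canonicalAbs_nonneg _)] at h2
  simp only [ENNReal.toReal_natCast, ENNReal.toReal_one] at h2
  rw [Nat.card_eq_fintype_card]
  exact eq_inv_of_mul_eq_one_right h2

theorem canonicalAbs_zero : canonicalAbs (0 : K) = 0 := by
  have hq : (1 : ℝ) < Nat.card 𝓀[K] := by exact_mod_cast one_lt_card_residue K
  have h : ∀ n : ℕ, canonicalAbs (0 : K) ≤ ((Nat.card 𝓀[K] : ℝ)⁻¹) ^ n := by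
    intro n
    have hn : canonicalAbs (uniformizer K ^ n) = ((Nat.card 𝓀[K] : ℝ)⁻¹) ^ n := by
      induction n with
      | zero => simp [canonicalAbs_one]
      | succ n ih =>
        rw [pow_succ, canonicalAbs_mul_of_ne_zero (pow_ne_zero _ uniformizer_ne_zero)
          uniformizer_ne_zero, ih, canonicalAbs_uniformizer, pow_succ]
    rw [← hn, canonicalAbs_eq, canonicalAbs_eq]
    apply ENNReal.toReal_mono
    · rw [normalizedHaar_smul (pow_ne_zero _ uniformizer_ne_zero), normalizedHaar_integer]
      simp
    · apply measure_mono
      rintro _ ⟨z, hz, rfl⟩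
      exact ⟨0, zero_mem _, by simp⟩
  refine le_antisymm (ge_of_tendsto' (tendsto_pow_atTop_nhds_zero_of_lt_one (by positivity)
    (inv_lt_one_of_one_lt₀ hq)) h) (canonicalAbs_nonneg _)

theorem canonicalAbs_mul (x y : K) : canonicalAbs (x * y) = canonicalAbs x * canonicalAbs y := by
  rcases eq_or_ne x 0 with rfl | hx
  · simp [canonicalAbs_zero]
  rcases eq_or_ne y 0 with rfl | hy
  · simp [canonicalAbs_zero]
  exact canonicalAbs_mul_of_ne_zero hx hy

variable (K) in
/-- The canonical absolute value as a homomorphism. -/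
noncomputable def canonicalAbsHom : K →*₀ ℝ where
  toFun := canonicalAbs
  map_zero' := canonicalAbs_zero
  map_one' := canonicalAbs_one
  map_mul' := canonicalAbs_mul

theorem canonicalAbs_eq_zero {x : K} : canonicalAbs x = 0 ↔ x = 0 :=
  map_eq_zero (canonicalAbsHom K)

theorem canonicalAbs_zpow (x : K) (m : ℤ) : canonicalAbs (x ^ m) = canonicalAbs x ^ m :=
  map_zpow₀ (canonicalAbsHom K) x m

theorem canonicalAbs_le_one {x : K} (hx : x ∈ 𝒪[K]) : canonicalAbs x ≤ 1 := by
  rw [canonicalAbs_eq, ← ENNReal.toReal_one, ← normalizedHaar_integer (K := K)]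
  apply ENNReal.toReal_mono
  · rw [normalizedHaar_integer]; simp
  · apply measure_mono
    rintro _ ⟨z, hz, rfl⟩
    exact mul_mem hx hz

theorem canonicalAbs_integer_unit (u : 𝒪[K]ˣ) : canonicalAbs ((u : 𝒪[K]) : K) = 1 := by
  have h : canonicalAbs ((u : 𝒪[K]) : K) * canonicalAbs (((u⁻¹ : 𝒪[K]ˣ) : 𝒪[K]) : K) = 1 := by
    rw [← canonicalAbs_mul, ← Subring.coe_mul]
    simp [canonicalAbs_one]
  have h1 := canonicalAbs_le_one (u : 𝒪[K]).2
  have h2 := canonicalAbs_le_one ((u⁻¹ : 𝒪[K]ˣ) : 𝒪[K]).2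
  nlinarith [canonicalAbs_nonneg ((u : 𝒪[K]) : K),
    canonicalAbs_nonneg (((u⁻¹ : 𝒪[K]ˣ) : 𝒪[K]) : K)]

theorem exists_canonicalAbs_eq_zpow {x : K} (hx : x ≠ 0) :
    ∃ m : ℤ, canonicalAbs x = (Nat.card 𝓀[K] : ℝ) ^ m := by
  obtain ⟨u, m, rfl⟩ := exists_unit_mul_zpow hx
  exact ⟨-m, by rw [canonicalAbs_mul, canonicalAbs_integer_unit, one_mul, canonicalAbs_zpow,
    canonicalAbs_uniformizer, inv_zpow, zpow_neg]⟩

theorem mem_integer_iff_canonicalAbs_le_one {x : K} : x ∈ 𝒪[K] ↔ canonicalAbs x ≤ 1 := by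
  refine ⟨canonicalAbs_le_one, fun h => ?_⟩
  rcases eq_or_ne x 0 with rfl | hx
  · exact zero_mem _
  obtain ⟨u, m, rfl⟩ := exists_unit_mul_zpow hx
  rw [canonicalAbs_mul, canonicalAbs_integer_unit, one_mul, canonicalAbs_zpow,
    canonicalAbs_uniformizer] at h
  have hq : (1 : ℝ) < Nat.card 𝓀[K] := by exact_mod_cast one_lt_card_residue K
  have hm : 0 ≤ m := by
    by_contra hm
    rw [inv_zpow, ← zpow_neg] at h
    exact absurd h (not_le.2 (one_lt_zpow₀ hq (by omega)))
  lift m to ℕ using hm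
  rw [zpow_natCast]
  exact mul_mem (u : 𝒪[K]).2 (pow_mem uniformizer_mem m)

theorem canonicalAbs_sub_eq_one {x y : K} (hx : x ∈ 𝒪[K]) (hy : y ∈ 𝒪[K]) (h : res x ≠ res y) :
    canonicalAbs (x - y) = 1 := by
  have hu : IsUnit (⟨x - y, sub_mem hx hy⟩ : 𝒪[K]) := by
    by_contra hu
    apply h
    rw [res, res, dif_pos hx, dif_pos hy, ← sub_eq_zero, ← map_sub,
      IsLocalRing.residue_eq_zero_iff]
    exact hu
  obtain ⟨u, hu⟩ := hu
  have := canonicalAbs_integer_unit u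
  rwa [hu] at this

theorem measurable_canonicalAbs : Measurable (canonicalAbs : K → ℝ) := by
  intro T _
  have ho : IsOpen ((canonicalAbs : K → ℝ) ⁻¹' T \ {0}) := by
    rw [isOpen_iff_mem_nhds]
    rintro x ⟨hxT, hx0⟩
    have hx0 : x ≠ 0 := hx0
    have hO : IsOpen ((fun y => (x * uniformizer K)⁻¹ * (y - x)) ⁻¹' (𝒪[K] : Set K)) :=
      (ValuativeRel.valuation K).isOpen_integer.preimage (by fun_prop)
    refine Filter.mem_of_superset (hO.mem_nhds (by simp [zero_mem])) ?_
    intro y hy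
    set z := (x * uniformizer K)⁻¹ * (y - x) with hz
    have hy' : y = x * (1 + uniformizer K * z) := by
      rw [hz]; field_simp [uniformizer_ne_zero (K := K)]; ring
    have hz' : z ∈ 𝒪[K] := hy
    have h1 : canonicalAbs (1 + uniformizer K * z) = 1 := by
      have hm : 1 + uniformizer K * z ∈ 𝒪[K] := add_mem (one_mem _) (mul_mem uniformizer_mem hz')
      have := canonicalAbs_sub_eq_one hm (zero_mem _) (by
        rw [(res_eq_iff hm (one_mem _)).2 ⟨z, hz', rfl⟩, res, res, dif_pos (one_mem _),
          dif_pos (zero_mem _)]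
        exact one_ne_zero)
      simpa using this
    have h2 : canonicalAbs y = canonicalAbs x := by rw [hy', canonicalAbs_mul, h1, mul_one]
    refine ⟨by simpa [h2] using hxT, fun h0 => ?_⟩
    rw [Set.mem_singleton_iff] at h0
    rw [h0, canonicalAbs_zero] at h2
    exact hx0 (canonicalAbs_eq_zero.1 h2.symm)
  by_cases h0 : (0 : K) ∈ (canonicalAbs : K → ℝ) ⁻¹' T
  · rw [← Set.insert_sdiff_self_of_mem h0]
    exact ho.measurableSet.insert _
  · rw [← Set.sdiff_singleton_eq_self h0]
    exact ho.measurableSet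

end Abs

end FieldBasics

theorem dependsOn_finset_prod {ι X M κ : Type*} [CommMonoid M] {s : Finset κ}
    {S : κ → Finset ι} {f : κ → (ι → X) → M} [DecidableEq ι]
    (h : ∀ k ∈ s, DependsOn (f k) (S k : Set ι)) :
    DependsOn (fun x => ∏ k ∈ s, f k x) (s.biUnion S : Set ι) := by
  intro x y hxy
  refine prod_congr rfl fun k hk => h k hk fun i hi => hxy i ?_
  simp only [coe_biUnion, Set.mem_iUnion]
  exact ⟨k, hk, hi⟩

section Independence

open ProbabilityTheory

variable {ι : Type*} [Fintype ι] {X : Type*} [MeasurableSpace X] [Nonempty X]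
  {ν : Measure X} [IsProbabilityMeasure ν]

theorem indepFun_of_dependsOn {E : Type*} [MeasurableSpace E] {S T : Finset ι}
    (hST : Disjoint S T) {f g : (ι → X) → E} (hf : Measurable f) (hg : Measurable g)
    (hfS : DependsOn f (S : Set ι)) (hgT : DependsOn g (T : Set ι)) :
    IndepFun f g (Measure.pi fun _ : ι => ν) := by
  classical
  have h := (iIndepFun_pi (μ := fun _ : ι => ν) (X := fun _ x => x)
    (fun _ => aemeasurable_id)).indepFun_finset S T hST (fun i => measurable_pi_apply i)
  obtain ⟨x₀⟩ := ‹Nonempty X›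
  have key : ∀ (U : Finset ι) (f : (ι → X) → E), Measurable f → DependsOn f (U : Set ι) →
      ∃ F : (U → X) → E, Measurable F ∧ f = F ∘ fun x (i : U) => x i := by
    intro U f hf hU
    let e : (U → X) → ι → X := fun y i => if hi : i ∈ U then y ⟨i, hi⟩ else x₀
    have he : Measurable e := by
      refine measurable_pi_lambda _ fun i => ?_
      by_cases hi : i ∈ U
      · simp only [e, hi, dif_pos]; exact measurable_pi_apply _
      · simp only [e, hi, dif_neg, not_false_eq_true]; exact measurable_const
    refine ⟨f ∘ e, hf.comp he, funext fun x => hU fun i hi => ?_⟩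
    have hi' : i ∈ U := hi
    simp [e, hi']
  obtain ⟨F, hF, rfl⟩ := key S f hf hfS
  obtain ⟨G, hG, rfl⟩ := key T g hg hgT
  exact h.comp hF hG

theorem lintegral_prod_of_dependsOn {κ : Type*} (s : Finset κ) (S : κ → Finset ι)
    (hS : (s : Set κ).PairwiseDisjoint S) (f : κ → (ι → X) → ℝ≥0∞)
    (hf : ∀ k ∈ s, Measurable (f k)) (hd : ∀ k ∈ s, DependsOn (f k) (S k : Set ι)) :
    ∫⁻ x, ∏ k ∈ s, f k x ∂(Measure.pi fun _ : ι => ν) =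
      ∏ k ∈ s, ∫⁻ x, f k x ∂(Measure.pi fun _ : ι => ν) := by
  classical
  induction s using Finset.induction_on with
  | empty => simp
  | insert k s hk ih =>
    simp only [prod_insert hk]
    have h1 : Measurable fun x => ∏ k ∈ s, f k x :=
      Finset.measurable_fun_prod _ fun j hj => hf j (mem_insert_of_mem hj)
    rw [lintegral_mul_eq_lintegral_mul_lintegral_of_indepFun'' (hf k (mem_insert_self _ _)).aemeasurable
      h1.aemeasurable, ih]
    · exact hS.subset (by simp)
    · exact fun j hj => hf j (mem_insert_of_mem hj)
    · exact fun j hj => hd j (mem_insert_of_mem hj)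
    · refine indepFun_of_dependsOn (S := S k) (T := s.biUnion S) ?_ (hf k (mem_insert_self _ _)) h1
        (hd k (mem_insert_self _ _))
        (dependsOn_finset_prod fun j hj => hd j (mem_insert_of_mem hj))
      rw [disjoint_biUnion_right]
      intro j hj
      exact hS (by simp) (by simp [hj]) (fun h => hk (h ▸ hj))

theorem integral_prod_of_dependsOn {κ : Type*} (s : Finset κ) (S : κ → Finset ι)
    (hS : (s : Set κ).PairwiseDisjoint S) (f : κ → (ι → X) → ℂ)
    (hf : ∀ k ∈ s, Measurable (f k)) (hd : ∀ k ∈ s, DependsOn (f k) (S k : Set ι)) :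
    ∫ x, ∏ k ∈ s, f k x ∂(Measure.pi fun _ : ι => ν) =
      ∏ k ∈ s, ∫ x, f k x ∂(Measure.pi fun _ : ι => ν) := by
  classical
  induction s using Finset.induction_on with
  | empty => simp
  | insert k s hk ih =>
    simp only [prod_insert hk]
    have h1 : Measurable fun x => ∏ k ∈ s, f k x :=
      Finset.measurable_fun_prod _ fun j hj => hf j (mem_insert_of_mem hj)
    rw [IndepFun.integral_fun_mul_eq_mul_integral _
      (hf k (mem_insert_self _ _)).aestronglyMeasurable h1.aestronglyMeasurable, ih]
    · exact hS.subset (by simp)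
    · exact fun j hj => hf j (mem_insert_of_mem hj)
    · exact fun j hj => hd j (mem_insert_of_mem hj)
    · refine indepFun_of_dependsOn (S := S k) (T := s.biUnion S) ?_ (hf k (mem_insert_self _ _)) h1
        (hd k (mem_insert_self _ _))
        (dependsOn_finset_prod fun j hj => hd j (mem_insert_of_mem hj))
      rw [disjoint_biUnion_right]
      intro j hj
      exact hS (by simp) (by simp [hj]) (fun h => hk (h ▸ hj))

end Independence

section Affine

variable {K : Type*} [Field K] [ValuativeRel K] [TopologicalSpace K]
  [IsNonarchimedeanLocalField K] [MeasurableSpace K] [BorelSpace K]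

attribute [local instance] secondCountableTopology t2Space

theorem map_affine_normalizedHaar {c : K} (hc : c ≠ 0) (b : K) :
    (normalizedHaar K).map (fun y => b + c * y) =
      ENNReal.ofReal (canonicalAbs c)⁻¹ • normalizedHaar K := by
  ext s hs
  have hm : Measurable fun y : K => b + c * y := by fun_prop
  rw [Measure.map_apply hm hs, Measure.smul_apply, smul_eq_mul]
  have : (fun y => b + c * y) ⁻¹' s = c⁻¹ • ((-b) +ᵥ s) := by
    ext y
    rw [Set.mem_smul_set_iff_inv_smul_mem₀ (inv_ne_zero hc), Set.mem_vadd_set_iff_neg_vadd_mem]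
    simp
  rw [this, normalizedHaar_smul (inv_ne_zero hc), measure_vadd]
  congr 2
  exact map_inv₀ (canonicalAbsHom K) c

/-- The coordinatewise affine map with a common slope. -/
noncomputable def affineMap {N : ℕ} (c : K) (hc : c ≠ 0) (b : Fin N → K) :
    (Fin N → K) ≃ᵐ (Fin N → K) :=
  MeasurableEquiv.piCongrRight fun i =>
    { toFun := fun y => b i + c * y
      invFun := fun x => c⁻¹ * (x - b i)
      left_inv := fun y => by field_simp; ring
      right_inv := fun x => by field_simp; ring
      measurable_toFun := by dsimp; fun_prop
      measurable_invFun := by dsimp; fun_prop }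

theorem affineMap_apply {N : ℕ} {c : K} (hc : c ≠ 0) (b y : Fin N → K) (i : Fin N) :
    affineMap c hc b y i = b i + c * y i := rfl

theorem map_affineMap_productHaar {N : ℕ} {c : K} (hc : c ≠ 0) (b : Fin N → K) :
    (productHaar K N).map (affineMap c hc b) =
      ENNReal.ofReal (canonicalAbs c)⁻¹ ^ N • productHaar K N := by
  have hsf : ∀ i, SigmaFinite ((normalizedHaar K).map fun y => b i + c * y) := by
    intro i
    rw [map_affine_normalizedHaar hc]
    exact (inferInstance : SigmaFinite ((canonicalAbs c)⁻¹.toNNReal • normalizedHaar K))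
  have h1 : (productHaar K N).map (affineMap c hc b) =
      Measure.pi fun i => (normalizedHaar K).map fun y => b i + c * y := by
    rw [productHaar, ← Measure.pi_map_pi (fun i => by fun_prop)]
    rfl
  rw [h1]
  refine (Measure.pi_eq fun s hs => ?_)
  rw [Measure.smul_apply, productHaar, Measure.pi_pi, smul_eq_mul]
  simp only [map_affine_normalizedHaar hc, Measure.smul_apply, smul_eq_mul, prod_mul_distrib,
    prod_const, card_univ, Fintype.card_fin]

variable (K) in
/-- The normalized Haar measure on the ring of integers. -/
noncomputable def integerMeasure : Measure K := (normalizedHaar K).restrict (𝒪[K] : Set K)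

instance : IsProbabilityMeasure (integerMeasure K) :=
  ⟨by rw [integerMeasure, Measure.restrict_apply_univ, normalizedHaar_integer]⟩

variable (K) in
/-- The product of the normalized Haar measures on the ring of integers. -/
noncomputable def cubeMeasure (N : ℕ) : Measure (Fin N → K) :=
  Measure.pi fun _ => integerMeasure K

instance (N : ℕ) : IsProbabilityMeasure (cubeMeasure K N) := by
  unfold cubeMeasure; infer_instance

variable (K) in
/-- The points with integral coordinates. -/
def cube (N : ℕ) : Set (Fin N → K) := {x | ∀ i, x i ∈ 𝒪[K]}

theorem measurableSet_cube (N : ℕ) : MeasurableSet (cube K N) := by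
  have : cube K N = Set.univ.pi fun _ => (𝒪[K] : Set K) := by ext; simp [cube]
  rw [this]
  exact MeasurableSet.univ_pi fun _ => measurableSet_integer

theorem cubeMeasure_eq (N : ℕ) : cubeMeasure K N = (productHaar K N).restrict (cube K N) := by
  have : cube K N = Set.univ.pi fun _ => (𝒪[K] : Set K) := by ext; simp [cube]
  rw [this, productHaar, Measure.restrict_pi_pi]
  rfl

/-- The points of the cube with prescribed residue classes. -/
def residueCell {N : ℕ} (a : Fin N → 𝓀[K]) : Set (Fin N → K) :=
  {x | ∀ i, x i ∈ 𝒪[K] ∧ res (x i) = a i}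

theorem restrict_image_affineMap {N : ℕ} {c : K} (hc : c ≠ 0) (b : Fin N → K) (s t : Set (Fin N → K))
    (ht : affineMap c hc b ⁻¹' t = s) :
    (productHaar K N).restrict t =
      ENNReal.ofReal (canonicalAbs c) ^ N •
        ((productHaar K N).restrict s).map (affineMap c hc b) := by
  rw [← ht, ← (affineMap c hc b).restrict_map, map_affineMap_productHaar, Measure.restrict_smul,
    smul_smul, ← mul_pow, ← ENNReal.ofReal_mul (canonicalAbs_nonneg _),
    mul_inv_cancel₀ (canonicalAbs_pos hc).ne']
  simp

theorem preimage_residueCell {N : ℕ} (a : Fin N → 𝓀[K]) :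
    affineMap (uniformizer K) uniformizer_ne_zero (fun i => lift (a i)) ⁻¹' residueCell a =
      cube K N := by
  ext y
  simp only [residueCell, Set.mem_preimage, Set.mem_ofPred_eq, integer_res_iff, affineMap_apply,
    cube]
  refine forall_congr' fun i => ⟨?_, fun h => ⟨_, h, rfl⟩⟩
  rintro ⟨z, hz, h⟩
  have := mul_left_cancel₀ uniformizer_ne_zero (add_left_cancel h)
  rwa [← this]

theorem measurableSet_residueCell {N : ℕ} (a : Fin N → 𝓀[K]) : MeasurableSet (residueCell a) := by
  rw [← (affineMap (uniformizer K) uniformizer_ne_zero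
    (fun i => lift (a i))).measurableSet_preimage, preimage_residueCell]
  exact measurableSet_cube N

theorem restrict_residueCell {N : ℕ} (a : Fin N → 𝓀[K]) :
    (cubeMeasure K N).restrict (residueCell a) =
      ((Nat.card 𝓀[K] : ℝ≥0∞)⁻¹) ^ N •
        (cubeMeasure K N).map (affineMap (uniformizer K) uniformizer_ne_zero
          (fun i => lift (a i))) := by
  have hsub : residueCell a ⊆ cube K N := fun x hx i => (hx i).1
  rw [cubeMeasure_eq, Measure.restrict_restrict (measurableSet_residueCell a),
    Set.inter_eq_left.2 hsub, restrict_image_affineMap _ _ _ _ (preimage_residueCell a),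
    canonicalAbs_uniformizer, ENNReal.ofReal_inv_of_pos, ENNReal.ofReal_natCast]
  exact_mod_cast Nat.card_pos

theorem setLIntegral_residueCell {N : ℕ} (a : Fin N → 𝓀[K]) (h : (Fin N → K) → ℝ≥0∞) :
    ∫⁻ x in residueCell a, h x ∂(cubeMeasure K N) = ((Nat.card 𝓀[K] : ℝ≥0∞)⁻¹) ^ N *
      ∫⁻ y, h (fun i => lift (a i) + uniformizer K * y i) ∂(cubeMeasure K N) := by
  rw [restrict_residueCell, lintegral_smul_measure, lintegral_map_equiv]
  rfl

theorem setIntegral_residueCell {N : ℕ} (a : Fin N → 𝓀[K]) (h : (Fin N → K) → ℂ) :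
    ∫ x in residueCell a, h x ∂(cubeMeasure K N) = ((Nat.card 𝓀[K] : ℂ)⁻¹) ^ N *
      ∫ y, h (fun i => lift (a i) + uniformizer K * y i) ∂(cubeMeasure K N) := by
  rw [restrict_residueCell, integral_smul_measure, integral_map_equiv]
  simp only [ENNReal.toReal_pow, ENNReal.toReal_inv, ENNReal.toReal_natCast, Complex.real_smul]
  push_cast
  rfl

theorem pairwise_disjoint_residueCell {N : ℕ} (s : Set (Fin N → 𝓀[K])) :
    s.PairwiseDisjoint (residueCell (K := K) (N := N)) := by
  intro a _ b _ hab
  rw [Function.onFun, Set.disjoint_left]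
  intro x hx hx'
  exact hab (funext fun i => (hx i).2.symm.trans (hx' i).2)

theorem ae_mem_cube (N : ℕ) : ∀ᵐ x ∂(cubeMeasure K N), x ∈ cube K N := by
  rw [cubeMeasure_eq]
  exact ae_restrict_mem (measurableSet_cube N)

/-- The union of the cells whose residue classes lie in a given set. -/
def residueUnion {N : ℕ} (A : Set (Fin N → 𝓀[K])) : Set (Fin N → K) :=
  {x | x ∈ cube K N ∧ (fun i => res (x i)) ∈ A}

theorem residueUnion_eq {N : ℕ} (A : Finset (Fin N → 𝓀[K])) :
    residueUnion (A : Set (Fin N → 𝓀[K])) = ⋃ a ∈ A, residueCell (K := K) (N := N) a := by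
  ext x
  simp only [residueUnion, Set.mem_ofPred_eq, Set.mem_iUnion, residueCell, cube]
  constructor
  · rintro ⟨h, h'⟩
    exact ⟨_, h', fun i => ⟨h i, rfl⟩⟩
  · rintro ⟨a, ha, h⟩
    refine ⟨fun i => (h i).1, ?_⟩
    rwa [show (fun i => res (x i)) = a from funext fun i => (h i).2]

theorem measurableSet_residueUnion {N : ℕ} (A : Finset (Fin N → 𝓀[K])) :
    MeasurableSet (residueUnion (K := K) (A : Set (Fin N → 𝓀[K]))) := by
  rw [residueUnion_eq]
  exact Finset.measurableSet_biUnion _ fun a _ => measurableSet_residueCell a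

theorem setLIntegral_residueUnion {N : ℕ} (A : Finset (Fin N → 𝓀[K])) (h : (Fin N → K) → ℝ≥0∞) :
    ∫⁻ x in residueUnion (A : Set (Fin N → 𝓀[K])), h x ∂(cubeMeasure K N) =
      ((Nat.card 𝓀[K] : ℝ≥0∞)⁻¹) ^ N * ∑ a ∈ A,
        ∫⁻ y, h (fun i => lift (a i) + uniformizer K * y i) ∂(cubeMeasure K N) := by
  rw [residueUnion_eq, lintegral_biUnion_finset (pairwise_disjoint_residueCell _)
    (fun a _ => measurableSet_residueCell a), mul_sum]
  exact sum_congr rfl fun a _ => setLIntegral_residueCell a h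

theorem setIntegral_residueUnion {N : ℕ} (A : Finset (Fin N → 𝓀[K])) (h : (Fin N → K) → ℂ)
    (hi : Integrable h (cubeMeasure K N)) :
    ∫ x in residueUnion (A : Set (Fin N → 𝓀[K])), h x ∂(cubeMeasure K N) =
      ((Nat.card 𝓀[K] : ℂ)⁻¹) ^ N * ∑ a ∈ A,
        ∫ y, h (fun i => lift (a i) + uniformizer K * y i) ∂(cubeMeasure K N) := by
  rw [residueUnion_eq, integral_biUnion_finset _ (fun a _ => measurableSet_residueCell a)
    (pairwise_disjoint_residueCell _) (fun a _ => hi.integrableOn), mul_sum]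
  exact sum_congr rfl fun a _ => setIntegral_residueCell a h

end Affine

section Partitions

variable {N : ℕ}

theorem mem_pairs {B : Finset (Fin N)} {p : Fin N × Fin N} :
    p ∈ pairs B ↔ (p.1 ∈ B ∧ p.2 ∈ B) ∧ p.1 < p.2 := by
  simp [pairs]

/-- The pairs of elements of a common block. -/
def blockPairs (P : Finpartition (univ : Finset (Fin N))) : Finset (Fin N × Fin N) :=
  (pairs univ).filter fun p => P.part p.1 = P.part p.2

theorem blockPairs_fiber (P : Finpartition (univ : Finset (Fin N))) {B : Finset (Fin N)}
    (hB : B ∈ P.parts) : {p ∈ blockPairs P | P.part p.1 = B} = pairs B := by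
  ext p
  simp only [blockPairs, mem_filter, mem_pairs, mem_univ, true_and]
  rw [← P.part_eq_iff_mem hB, ← P.part_eq_iff_mem hB]
  constructor
  · rintro ⟨⟨h1, h2⟩, h3⟩
    exact ⟨⟨h3, h2 ▸ h3⟩, h1⟩
  · rintro ⟨⟨h1, h2⟩, h3⟩
    exact ⟨⟨h3, h1.trans h2.symm⟩, h1⟩

@[to_additive]
theorem prod_blockPairs {M : Type*} [CommMonoid M] (P : Finpartition (univ : Finset (Fin N)))
    (g : Fin N × Fin N → M) :
    ∏ p ∈ blockPairs P, g p = ∏ B ∈ P.parts, ∏ p ∈ pairs B, g p := by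
  rw [← prod_fiberwise_of_maps_to (s := blockPairs P) (t := P.parts) (g := fun p => P.part p.1)
    (fun p _ => P.part_mem.2 (mem_univ _))]
  exact prod_congr rfl fun B hB => by rw [blockPairs_fiber P hB]

/-- The partition into the fibres of a function. -/
def fiberPartition {β : Type*} [DecidableEq β] (f : Fin N → β) :
    Finpartition (univ : Finset (Fin N)) :=
  Finpartition.ofSetoid (Setoid.ker f)

theorem part_eq_part_iff (P : Finpartition (univ : Finset (Fin N))) {i j : Fin N} :
    P.part i = P.part j ↔ j ∈ P.part i := by
  rw [P.part_eq_iff_mem (P.part_mem.2 (mem_univ _)), P.mem_part_iff_part_eq_part (mem_univ _) (mem_univ _),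
    P.mem_part_iff_part_eq_part (mem_univ _) (mem_univ _), eq_comm]

theorem fiberPartition_part {β : Type*} [DecidableEq β] (f : Fin N → β) {i j : Fin N} :
    (fiberPartition f).part i = (fiberPartition f).part j ↔ f i = f j := by
  rw [part_eq_part_iff]
  exact Finpartition.mem_part_ofSetoid_iff_rel

theorem finpartition_ext_part {P Q : Finpartition (univ : Finset (Fin N))}
    (h : ∀ i j, P.part i = P.part j ↔ Q.part i = Q.part j) : P = Q := by
  have hp : ∀ i, P.part i = Q.part i := fun i => by
    ext j; rw [← part_eq_part_iff, ← part_eq_part_iff, h]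
  have key : ∀ {P Q : Finpartition (univ : Finset (Fin N))}, (∀ i, P.part i = Q.part i) →
      P.parts ⊆ Q.parts := by
    intro P Q hp B hB
    obtain ⟨i, hi⟩ := P.nonempty_of_mem_parts hB
    rw [← P.part_eq_of_mem hB hi, hp]
    exact Q.part_mem.2 (mem_univ _)
  exact Finpartition.ext (Subset.antisymm (key hp) (key fun i => (hp i).symm))

/-- The partition into the traces of the fibres of a function on the blocks. -/
def refineBy {β : Type*} [DecidableEq β] (P : Finpartition (univ : Finset (Fin N)))
    (a : Fin N → β) : Finpartition (univ : Finset (Fin N)) :=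
  fiberPartition fun i => (P.part i, a i)

theorem refineBy_part {β : Type*} [DecidableEq β] (P : Finpartition (univ : Finset (Fin N)))
    (a : Fin N → β) {i j : Fin N} :
    (refineBy P a).part i = (refineBy P a).part j ↔ P.part i = P.part j ∧ a i = a j := by
  rw [refineBy, fiberPartition_part, Prod.mk.injEq]

/-- The partition with the block `B` and singletons. -/
def isolate (B : Finset (Fin N)) : Finpartition (univ : Finset (Fin N)) :=
  fiberPartition fun i => if i ∈ B then none else some i

theorem isolate_part (B : Finset (Fin N)) {i j : Fin N} :
    (isolate B).part i = (isolate B).part j ↔ i = j ∨ (i ∈ B ∧ j ∈ B) := by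
  rw [isolate, fiberPartition_part]
  by_cases hi : i ∈ B <;> by_cases hj : j ∈ B <;> simp [hi, hj]
  · rintro rfl; exact hj hi
  · rintro rfl; exact hi hj

theorem blockPairs_isolate (B : Finset (Fin N)) : blockPairs (isolate B) = pairs B := by
  ext p
  simp only [blockPairs, mem_filter, mem_pairs, mem_univ, true_and, isolate_part]
  constructor
  · rintro ⟨h1, h2 | h2⟩
    · exact absurd h2 h1.ne
    · exact ⟨h2, h1⟩
  · rintro ⟨h1, h2⟩
    exact ⟨h2, .inr h1⟩

theorem blockPairs_refineBy {β : Type*} [DecidableEq β]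
    (P : Finpartition (univ : Finset (Fin N))) (a : Fin N → β) :
    blockPairs (refineBy P a) = {p ∈ blockPairs P | a p.1 = a p.2} := by
  ext p
  simp only [blockPairs, mem_filter, refineBy_part, and_assoc]

/-- The functions that are constant on a nonempty set. -/
theorem card_constant_on {β : Type*} [Fintype β] [DecidableEq β] {B : Finset (Fin N)}
    (hB : B.Nonempty) :
    #{a : Fin N → β | ∀ i ∈ B, ∀ j ∈ B, a i = a j} * Fintype.card β ^ #B =
      Fintype.card β ^ (N + 1) := by
  obtain ⟨i₀, h₀⟩ := hB
  have : ({a : Fin N → β | ∀ i ∈ B, ∀ j ∈ B, a i = a j} : Finset _) =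
      univ.biUnion fun c : β => Fintype.piFinset fun i => if i ∈ B then {c} else univ := by
    ext a
    simp only [mem_filter, mem_univ, true_and, mem_biUnion, Fintype.mem_piFinset]
    constructor
    · intro h
      refine ⟨a i₀, fun i => ?_⟩
      by_cases hi : i ∈ B <;> simp [hi]
      exact h i hi _ h₀
    · rintro ⟨c, h⟩
      have h' : ∀ i ∈ B, a i = c := fun i hi => by simpa [hi] using h i
      exact fun i hi j hj => (h' i hi).trans (h' j hj).symm
  rw [this, card_biUnion]
  · simp only [Fintype.card_piFinset, apply_ite card, card_singleton, prod_ite, prod_const_one,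
      one_mul, prod_const, sum_const, smul_eq_mul, card_univ]
    have h1 : #{x : Fin N | x ∉ B} + #B = N := by
      have := card_compl_add_card B
      rw [Fintype.card_fin] at this
      rwa [← compl_filter, filter_mem_eq_inter, univ_inter]
    rw [mul_assoc, ← pow_add, h1, pow_succ']
  · intro c _ c' _ hcc
    rw [Function.onFun, disjoint_left]
    intro a ha ha'
    rw [Fintype.mem_piFinset] at ha ha'
    have h1 := ha i₀
    have h2 := ha' i₀
    simp only [h₀, if_true, mem_singleton] at h1 h2
    exact hcc (h1.symm.trans h2)

end Partitions

theorem natCast_card_ne_zero (K : Type*) [Field K] [ValuativeRel K] [TopologicalSpace K]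
    [IsNonarchimedeanLocalField K] : (Nat.card 𝓀[K] : ℂ) ≠ 0 := by
  exact_mod_cast (Nat.card_pos (α := 𝓀[K])).ne'

section Interaction

variable {K : Type*} [Field K] [ValuativeRel K] [TopologicalSpace K]
  [IsNonarchimedeanLocalField K] [MeasurableSpace K] [BorelSpace K] {N : ℕ}

attribute [local instance] secondCountableTopology t2Space

/-- The product `∏ |x_i - x_j|^{s_{ij}}` over a set of pairs. -/
noncomputable def interaction (s : Fin N → Fin N → ℂ) (E : Finset (Fin N × Fin N))
    (x : Fin N → K) : ℂ :=
  ∏ p ∈ E, ((canonicalAbs (x p.1 - x p.2) : ℝ) : ℂ) ^ s p.1 p.2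

theorem measurable_interaction (s : Fin N → Fin N → ℂ) (E : Finset (Fin N × Fin N)) :
    Measurable (interaction (K := K) s E) := by
  refine Finset.measurable_fun_prod _ fun p _ => ?_
  refine Measurable.pow_const (Complex.measurable_ofReal.comp (measurable_canonicalAbs.comp ?_)) _
  fun_prop

theorem dependsOn_interaction (s : Fin N → Fin N → ℂ) (B : Finset (Fin N)) :
    DependsOn (interaction (K := K) s (pairs B)) (B : Set (Fin N)) := by
  intro x y h
  refine prod_congr rfl fun p hp => ?_
  rw [mem_pairs] at hp
  rw [h _ hp.1.1, h _ hp.1.2]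

theorem interaction_blockPairs (s : Fin N → Fin N → ℂ)
    (P : Finpartition (univ : Finset (Fin N))) (x : Fin N → K) :
    interaction s (blockPairs P) x = ∏ B ∈ P.parts, interaction s (pairs B) x :=
  prod_blockPairs P _

theorem canonicalAbs_smul_cpow (c x : K) (z : ℂ) :
    ((canonicalAbs (c * x) : ℝ) : ℂ) ^ z =
      ((canonicalAbs c : ℝ) : ℂ) ^ z * ((canonicalAbs x : ℝ) : ℂ) ^ z := by
  rw [canonicalAbs_mul, Complex.ofReal_mul,
    Complex.mul_cpow_ofReal_nonneg (canonicalAbs_nonneg _) (canonicalAbs_nonneg _)]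

theorem canonicalAbs_uniformizer_cpow (z : ℂ) :
    ((canonicalAbs (uniformizer K) : ℝ) : ℂ) ^ z = (Nat.card 𝓀[K] : ℂ) ^ (-z) := by
  rw [canonicalAbs_uniformizer, Complex.ofReal_inv, Complex.ofReal_natCast, Complex.inv_cpow,
    Complex.cpow_neg]
  rw [Complex.natCast_arg]
  exact Real.pi_pos.ne

theorem cpow_finset_sum {ι : Type*} (E : Finset ι) (g : ι → ℂ) {c : ℂ} (hc : c ≠ 0) :
    c ^ (∑ p ∈ E, g p) = ∏ p ∈ E, c ^ g p := by
  classical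
  induction E using Finset.induction_on with
  | empty => simp
  | insert p E hp ih => rw [sum_insert hp, prod_insert hp, Complex.cpow_add _ _ hc, ih]

theorem interaction_smul (s : Fin N → Fin N → ℂ) (E : Finset (Fin N × Fin N)) {c : K} (hc : c ≠ 0)
    (x : Fin N → K) :
    interaction s E (fun i => c * x i) =
      ((canonicalAbs c : ℝ) : ℂ) ^ (∑ p ∈ E, s p.1 p.2) * interaction s E x := by
  have h0 : ((canonicalAbs c : ℝ) : ℂ) ≠ 0 := by exact_mod_cast (canonicalAbs_pos hc).ne'
  rw [interaction, interaction, cpow_finset_sum _ _ h0, ← prod_mul_distrib]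
  refine prod_congr rfl fun p _ => ?_
  rw [← mul_sub, canonicalAbs_smul_cpow]

theorem interaction_lift_add (s : Fin N → Fin N → ℂ) (P : Finpartition (univ : Finset (Fin N)))
    [DecidableEq 𝓀[K]] (a : Fin N → 𝓀[K]) {y : Fin N → K} (hy : y ∈ cube K N) :
    interaction s (blockPairs P) (fun i => lift (a i) + uniformizer K * y i) =
      (Nat.card 𝓀[K] : ℂ) ^ (-∑ p ∈ blockPairs (refineBy P a), s p.1 p.2) *
        interaction s (blockPairs (refineBy P a)) y := by
  rw [← canonicalAbs_uniformizer_cpow, ← interaction_smul s _ uniformizer_ne_zero,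
    blockPairs_refineBy, interaction, interaction, prod_filter]
  refine prod_congr rfl fun p _ => ?_
  have hm : ∀ i, lift (a i) + uniformizer K * y i ∈ 𝒪[K] ∧
      res (lift (a i) + uniformizer K * y i) = a i := fun i => integer_res_iff.2 ⟨_, hy i, rfl⟩
  split_ifs with h
  · rw [h, add_sub_add_left_eq_sub]
  · rw [canonicalAbs_sub_eq_one (hm p.1).1 (hm p.2).1 (by rwa [(hm p.1).2, (hm p.2).2])]
    simp

end Interaction

theorem enorm_finset_prod {ι : Type*} (E : Finset ι) (g : ι → ℂ) :
    ‖∏ p ∈ E, g p‖ₑ = ∏ p ∈ E, ‖g p‖ₑ := by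
  classical
  induction E using Finset.induction_on with
  | empty => simp
  | insert p E hp ih => rw [prod_insert hp, prod_insert hp, enorm_mul, ih]

section Moments

variable {K : Type*} [Field K] [ValuativeRel K] [TopologicalSpace K]
  [IsNonarchimedeanLocalField K] [MeasurableSpace K] [BorelSpace K] {N : ℕ}

attribute [local instance] secondCountableTopology t2Space

theorem residueUnion_compl_ae_eq [Fintype 𝓀[K]] [DecidableEq 𝓀[K]] (A : Finset (Fin N → 𝓀[K])) :
    ((residueUnion (A : Set (Fin N → 𝓀[K])))ᶜ : Set (Fin N → K)) =ᵐ[cubeMeasure K N]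
      (residueUnion ((Aᶜ : Finset (Fin N → 𝓀[K])) : Set (Fin N → 𝓀[K])) : Set (Fin N → K)) := by
  filter_upwards [ae_mem_cube N] with x hx
  refine propext ?_
  change ¬ (x ∈ cube K N ∧ _) ↔ (x ∈ cube K N ∧ _)
  simp [hx]

theorem lintegral_residueUnion_add [Fintype 𝓀[K]] [DecidableEq 𝓀[K]] (A : Finset (Fin N → 𝓀[K]))
    (h : (Fin N → K) → ℝ≥0∞) :
    ∫⁻ x in residueUnion (A : Set (Fin N → 𝓀[K])), h x ∂(cubeMeasure K N) +
      ∫⁻ x in residueUnion ((Aᶜ : Finset (Fin N → 𝓀[K])) : Set (Fin N → 𝓀[K])), h x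
        ∂(cubeMeasure K N) = ∫⁻ x, h x ∂(cubeMeasure K N) := by
  rw [← setLIntegral_congr (residueUnion_compl_ae_eq A),
    lintegral_add_compl _ (measurableSet_residueUnion A)]

theorem integral_residueUnion_add [Fintype 𝓀[K]] [DecidableEq 𝓀[K]] (A : Finset (Fin N → 𝓀[K]))
    {h : (Fin N → K) → ℂ} (hi : Integrable h (cubeMeasure K N)) :
    ∫ x in residueUnion (A : Set (Fin N → 𝓀[K])), h x ∂(cubeMeasure K N) +
      ∫ x in residueUnion ((Aᶜ : Finset (Fin N → 𝓀[K])) : Set (Fin N → 𝓀[K])), h x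
        ∂(cubeMeasure K N) = ∫ x, h x ∂(cubeMeasure K N) := by
  rw [← setIntegral_congr_set (residueUnion_compl_ae_eq A),
    integral_add_compl (measurableSet_residueUnion A) hi]

theorem pairs_eq_empty {B : Finset (Fin N)} (hB : #B ≤ 1) : pairs B = ∅ := by
  rw [eq_empty_iff_forall_notMem]
  intro p hp
  rw [mem_pairs] at hp
  exact hp.2.ne (card_le_one.1 hB _ hp.1.1 _ hp.1.2)

/-- The residue vectors that are constant on a set. -/
def constantOn (K : Type*) [Field K] [ValuativeRel K] [Fintype 𝓀[K]] [DecidableEq 𝓀[K]]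
    (B : Finset (Fin N)) : Finset (Fin N → 𝓀[K]) :=
  {a | ∀ i ∈ B, ∀ j ∈ B, a i = a j}

theorem refineBy_isolate [Fintype 𝓀[K]] [DecidableEq 𝓀[K]] {B : Finset (Fin N)}
    {a : Fin N → 𝓀[K]} (ha : a ∈ constantOn K B) : refineBy (isolate B) a = isolate B := by
  apply finpartition_ext_part
  intro i j
  rw [refineBy_part, isolate_part]
  simp only [constantOn, mem_filter, mem_univ, true_and] at ha
  constructor
  · exact fun h => h.1
  · rintro (rfl | h)
    · exact ⟨.inl rfl, rfl⟩
    · exact ⟨.inr h, ha i h.1 j h.2⟩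

theorem card_lt_of_mem_refineBy_isolate [Fintype 𝓀[K]] [DecidableEq 𝓀[K]] {B : Finset (Fin N)}
    (hB : 1 < #B) {a : Fin N → 𝓀[K]} (ha : a ∉ constantOn K B) {A : Finset (Fin N)}
    (hA : A ∈ (refineBy (isolate B) a).parts) : #A < #B := by
  by_cases hA1 : #A ≤ 1
  · omega
  apply card_lt_card
  have hp : ∀ i ∈ A, ∀ j ∈ A, (i = j ∨ (i ∈ B ∧ j ∈ B)) ∧ a i = a j := by
    intro i hi j hj
    rw [← isolate_part, ← refineBy_part, Finpartition.part_eq_of_mem _ hA hi,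
      Finpartition.part_eq_of_mem _ hA hj]
  have hsub : A ⊆ B := by
    intro i hi
    obtain ⟨j, hj, hji⟩ := exists_mem_ne (by omega : 1 < #A) i
    rcases (hp i hi j hj).1 with h | h
    · exact absurd h.symm hji
    · exact h.1
  refine ⟨hsub, fun h => ha ?_⟩
  simp only [constantOn, mem_filter, mem_univ, true_and]
  exact fun i hi j hj => (hp i (h hi) j (h hj)).2

theorem card_constantOn_mul [Fintype 𝓀[K]] [DecidableEq 𝓀[K]] (s : Fin N → Fin N → ℂ)
    {B : Finset (Fin N)} (hB : B.Nonempty) :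
    ((Nat.card 𝓀[K] : ℂ)⁻¹) ^ N * (#(constantOn K B) *
      (Nat.card 𝓀[K] : ℂ) ^ (-∑ p ∈ pairs B, s p.1 p.2)) =
      (Nat.card 𝓀[K] : ℂ) ^ (-branchExponent B s) := by
  have h : (#(constantOn K B) : ℂ) * (Nat.card 𝓀[K] : ℂ) ^ #B = (Nat.card 𝓀[K] : ℂ) ^ (N + 1) := by
    rw [Nat.card_eq_fintype_card]
    exact_mod_cast card_constant_on (β := 𝓀[K]) hB
  have hq := natCast_card_ne_zero K
  have h2 : (Nat.card 𝓀[K] : ℂ) ^ (-branchExponent B s) =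
      ((Nat.card 𝓀[K] : ℂ) ^ #B)⁻¹ * (Nat.card 𝓀[K] : ℂ) *
        (Nat.card 𝓀[K] : ℂ) ^ (-∑ p ∈ pairs B, s p.1 p.2) := by
    have : -branchExponent B s = -(#B : ℂ) + 1 + (-∑ p ∈ pairs B, s p.1 p.2) := by
      rw [branchExponent]; ring
    rw [this, Complex.cpow_add _ _ hq, Complex.cpow_add _ _ hq, Complex.cpow_neg,
      Complex.cpow_natCast, Complex.cpow_one]
  rw [h2, ← mul_assoc]
  congr 1
  rw [inv_pow, inv_mul_eq_iff_eq_mul₀ (pow_ne_zero _ hq), ← div_eq_inv_mul, ← mul_div_assoc,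
    eq_div_iff (pow_ne_zero _ hq), h, pow_succ]

theorem lintegral_interaction_blockPairs (s : Fin N → Fin N → ℂ)
    (P : Finpartition (univ : Finset (Fin N))) :
    ∫⁻ x, ‖interaction (K := K) s (blockPairs P) x‖ₑ ∂(cubeMeasure K N) =
      ∏ B ∈ P.parts, ∫⁻ x, ‖interaction (K := K) s (pairs B) x‖ₑ ∂(cubeMeasure K N) := by
  rw [cubeMeasure, ← lintegral_prod_of_dependsOn P.parts id P.disjoint
    (fun B x => ‖interaction (K := K) s (pairs B) x‖ₑ)]
  · refine lintegral_congr fun x => ?_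
    rw [interaction_blockPairs, enorm_finset_prod]
  · exact fun B _ => (measurable_interaction s _).enorm
  · exact fun B _ x y h => by
      simp only
      rw [dependsOn_interaction s B h]

theorem integral_interaction_blockPairs (s : Fin N → Fin N → ℂ)
    (P : Finpartition (univ : Finset (Fin N))) :
    ∫ x, interaction (K := K) s (blockPairs P) x ∂(cubeMeasure K N) =
      ∏ B ∈ P.parts, ∫ x, interaction (K := K) s (pairs B) x ∂(cubeMeasure K N) := by
  rw [cubeMeasure, ← integral_prod_of_dependsOn P.parts id P.disjoint
    (fun B x => interaction (K := K) s (pairs B) x)]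
  · exact integral_congr_ae (ae_of_all _ fun x => interaction_blockPairs s P x)
  · exact fun B _ => measurable_interaction s _
  · exact fun B _ => dependsOn_interaction s B

theorem lintegral_interaction_lift [DecidableEq 𝓀[K]] (s : Fin N → Fin N → ℂ)
    (P : Finpartition (univ : Finset (Fin N))) (a : Fin N → 𝓀[K]) :
    ∫⁻ y, ‖interaction (K := K) s (blockPairs P) (fun i => lift (a i) + uniformizer K * y i)‖ₑ
        ∂(cubeMeasure K N) =
      ‖(Nat.card 𝓀[K] : ℂ) ^ (-∑ p ∈ blockPairs (refineBy P a), s p.1 p.2)‖ₑ *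
        ∫⁻ y, ‖interaction (K := K) s (blockPairs (refineBy P a)) y‖ₑ ∂(cubeMeasure K N) := by
  rw [← lintegral_const_mul' _ _ enorm_ne_top]
  refine lintegral_congr_ae ?_
  filter_upwards [ae_mem_cube N] with y hy
  rw [interaction_lift_add s P a hy, enorm_mul]

theorem integral_interaction_lift [DecidableEq 𝓀[K]] (s : Fin N → Fin N → ℂ)
    (P : Finpartition (univ : Finset (Fin N))) (a : Fin N → 𝓀[K]) :
    ∫ y, interaction (K := K) s (blockPairs P) (fun i => lift (a i) + uniformizer K * y i)
        ∂(cubeMeasure K N) =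
      (Nat.card 𝓀[K] : ℂ) ^ (-∑ p ∈ blockPairs (refineBy P a), s p.1 p.2) *
        ∫ y, interaction (K := K) s (blockPairs (refineBy P a)) y ∂(cubeMeasure K N) := by
  rw [← integral_const_mul]
  refine integral_congr_ae ?_
  filter_upwards [ae_mem_cube N] with y hy
  exact interaction_lift_add s P a hy

theorem enorm_interaction_le_one {s : Fin N → Fin N → ℂ} (hs : ∀ i j, 0 ≤ (s i j).re)
    (E : Finset (Fin N × Fin N)) {x : Fin N → K} (hx : x ∈ cube K N) :
    ‖interaction s E x‖ₑ ≤ 1 := by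
  rw [interaction, enorm_finset_prod]
  refine prod_le_one' fun p _ => ?_
  have h1 := canonicalAbs_le_one (sub_mem (hx p.1) (hx p.2))
  have h0 := canonicalAbs_nonneg (x p.1 - x p.2)
  rw [← (enorm_one : ‖(1 : ℂ)‖ₑ = 1), enorm_le_iff_norm_le, norm_one]
  rcases h0.eq_or_lt with h | h
  · rw [← h, Complex.ofReal_zero]
    by_cases hz : s p.1 p.2 = 0
    · simp [hz]
    · simp [Complex.zero_cpow hz]
  · rw [Complex.norm_cpow_eq_rpow_re_of_pos h]
    exact Real.rpow_le_one h0 h1 (hs _ _)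

theorem le_of_le_mul_add {r T C : ℝ≥0∞} (hr : r < 1) (hT : T ≠ ∞) (h : T ≤ r * T + C) :
    T ≤ C / (1 - r) := by
  have hr' : 1 - r ≠ 0 := (tsub_pos_of_lt hr).ne'
  rw [ENNReal.le_div_iff_mul_le (.inl hr') (.inl (by simp))]
  have h1 : r * T + T * (1 - r) = T := by
    rw [mul_comm T, ← add_mul, add_tsub_cancel_of_le hr.le, one_mul]
  have h2 : r * T + T * (1 - r) ≤ r * T + C := by rwa [h1]
  exact (ENNReal.add_le_add_iff_left (ENNReal.mul_ne_top (hr.trans ENNReal.one_lt_top).ne hT)).1 h2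

theorem lintegral_interaction_lt_top {s : Fin N → Fin N → ℂ}
    (hs : ∀ B : Finset (Fin N), 1 < #B → 0 < (branchExponent B s).re)
    (hsign : (∀ i j, 0 ≤ (s i j).re) ∨ (∀ i j, (s i j).re ≤ 0)) (B : Finset (Fin N)) :
    ∫⁻ x, ‖interaction (K := K) s (pairs B) x‖ₑ ∂(cubeMeasure K N) < ∞ := by
  classical
  have := Fintype.ofFinite 𝓀[K]
  rcases hsign with hsign | hsign
  · refine lt_of_le_of_lt (b := ∫⁻ _, 1 ∂(cubeMeasure K N)) (lintegral_mono_ae ?_) (by simp)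
    filter_upwards [ae_mem_cube N] with x hx using enorm_interaction_le_one hsign _ hx
  induction hn : #B using Nat.strong_induction_on generalizing B with
  | _ n ih =>
  subst hn
  rcases le_or_gt #B 1 with hB | hB
  · simp [interaction, pairs_eq_empty hB]
  set c : ℝ≥0∞ := ‖(Nat.card 𝓀[K] : ℂ) ^ (-∑ p ∈ pairs B, s p.1 p.2)‖ₑ with hc
  have hq1 : (1 : ℝ) < Nat.card 𝓀[K] := by exact_mod_cast one_lt_card_residue K
  have hnorm : ∀ z : ℂ, ‖(Nat.card 𝓀[K] : ℂ) ^ z‖ = (Nat.card 𝓀[K] : ℝ) ^ z.re := fun z => by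
    rw [← Complex.ofReal_natCast, Complex.norm_cpow_eq_rpow_re_of_pos (by linarith)]
  have hc1 : 1 ≤ c := by
    rw [hc, ← (enorm_one : ‖(1 : ℂ)‖ₑ = 1), enorm_le_iff_norm_le, norm_one, hnorm]
    apply Real.one_le_rpow hq1.le
    rw [Complex.neg_re, Complex.re_sum]
    exact neg_nonneg.2 (sum_nonpos fun p _ => hsign _ _)
  set f : (Fin N → K) → ℝ≥0∞ := fun x => ‖interaction s (pairs B) x‖ₑ with hf
  have hfm : Measurable f := (measurable_interaction s _).enorm
  set C := ∫⁻ x in residueUnion (((constantOn K B)ᶜ : Finset (Fin N → 𝓀[K])) :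
    Set (Fin N → 𝓀[K])), f x ∂(cubeMeasure K N) with hC
  have hCtop : C ≠ ∞ := by
    rw [hC, setLIntegral_residueUnion]
    refine ENNReal.mul_ne_top (ENNReal.pow_ne_top (ENNReal.inv_ne_top.2 ?_)) ?_
    · exact_mod_cast (Nat.card_pos (α := 𝓀[K])).ne'
    refine ENNReal.sum_ne_top.2 fun a ha => ?_
    simp only [hf, ← blockPairs_isolate B]
    rw [lintegral_interaction_lift, lintegral_interaction_blockPairs]
    refine ENNReal.mul_ne_top enorm_ne_top (ENNReal.prod_ne_top fun A hA => (ih _ ?_ A rfl).ne)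
    exact card_lt_of_mem_refineBy_isolate hB (by simpa using ha) hA
  set r : ℝ≥0∞ := ‖(Nat.card 𝓀[K] : ℂ) ^ (-branchExponent B s)‖ₑ with hr
  have hr1 : r < 1 := by
    rw [hr, ← (enorm_one : ‖(1 : ℂ)‖ₑ = 1), ← not_le, enorm_le_iff_norm_le, not_le, norm_one, hnorm]
    exact Real.rpow_lt_one_of_one_lt_of_neg hq1 (by simpa using hs B hB)
  have hcr : ((Nat.card 𝓀[K] : ℝ≥0∞)⁻¹) ^ N * (#(constantOn K B) * c) = r := by
    rw [hr, ← card_constantOn_mul s (card_pos.1 (by omega)), enorm_mul, enorm_mul, enorm_pow,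
      enorm_inv (natCast_card_ne_zero K)]
    have hnat : ∀ n : ℕ, ‖(n : ℂ)‖ₑ = n := fun n => by rw [← ofReal_norm, Complex.norm_natCast]; simp
    rw [hnat, hnat, hc]
  have hbound : ∀ M : ℕ, ∫⁻ x, min (f x) M ∂(cubeMeasure K N) ≤ C / (1 - r) := by
    intro M
    apply le_of_le_mul_add hr1
    · refine ne_top_of_le_ne_top (b := (M : ℝ≥0∞)) (by simp) ?_
      calc _ ≤ ∫⁻ _, (M : ℝ≥0∞) ∂(cubeMeasure K N) := lintegral_mono fun x => min_le_right _ _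
        _ = M := by simp
    · refine (lintegral_residueUnion_add (constantOn K B) _).symm.le.trans ?_
      refine add_le_add ?_ (lintegral_mono fun x => min_le_left _ _)
      rw [setLIntegral_residueUnion, ← hcr, mul_assoc, mul_assoc]
      refine mul_le_mul_right ?_ _
      rw [← nsmul_eq_mul]
      refine sum_le_card_nsmul _ _ _ fun a ha => ?_
      rw [← lintegral_const_mul' _ _ (by rw [hc]; exact enorm_ne_top)]
      refine lintegral_mono_ae ?_
      filter_upwards [ae_mem_cube N] with y hy
      have : f (fun i => lift (a i) + uniformizer K * y i) = c * f y := by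
        simp only [hf, hc]
        conv_lhs => rw [← blockPairs_isolate B, interaction_lift_add s _ a hy, enorm_mul,
          refineBy_isolate ha, blockPairs_isolate]
      rw [this, mul_min]
      refine min_le_min_left _ ?_
      calc (M : ℝ≥0∞) = 1 * M := (one_mul _).symm
        _ ≤ c * M := mul_le_mul_left hc1 _
  have hsup : ∀ x, f x = ⨆ M : ℕ, min (f x) M := by
    intro x
    rw [← inf_iSup_eq, ENNReal.iSup_natCast, inf_top_eq]
  change ∫⁻ x, f x ∂_ < ∞
  simp_rw +singlePass [hsup]
  rw [lintegral_iSup (fun M => hfm.min measurable_const)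
    (fun M M' h x => min_le_min_left _ (by exact_mod_cast h))]
  exact (iSup_le hbound).trans_lt (ENNReal.div_lt_top hCtop (tsub_pos_of_lt hr1).ne')

theorem integrable_interaction {s : Fin N → Fin N → ℂ}
    (hs : ∀ B : Finset (Fin N), 1 < #B → 0 < (branchExponent B s).re)
    (hsign : (∀ i j, 0 ≤ (s i j).re) ∨ (∀ i j, (s i j).re ≤ 0))
    (P : Finpartition (univ : Finset (Fin N))) :
    Integrable (interaction (K := K) s (blockPairs P)) (cubeMeasure K N) := by
  refine ⟨(measurable_interaction s _).aestronglyMeasurable, ?_⟩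
  rw [HasFiniteIntegral, lintegral_interaction_blockPairs]
  exact ENNReal.prod_lt_top fun B _ => lintegral_interaction_lt_top hs hsign B

end Moments

section Counting

variable {N : ℕ} {β : Type*} [DecidableEq β]

theorem part_subset_of_le {P Q : Finpartition (univ : Finset (Fin N))} (h : Q ≤ P) (i : Fin N) :
    Q.part i ⊆ P.part i := by
  obtain ⟨B, hB, hsub⟩ := h (Q.part_mem.2 (mem_univ i))
  rwa [P.part_eq_of_mem hB (hsub (Q.mem_part_self.2 (mem_univ i)))]

theorem refineBy_le (P : Finpartition (univ : Finset (Fin N))) (a : Fin N → β) :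
    refineBy P a ≤ P := by
  intro A hA
  obtain ⟨i, hi⟩ := Finpartition.nonempty_of_mem_parts _ hA
  refine ⟨P.part i, P.part_mem.2 (mem_univ _), fun j hj => ?_⟩
  rw [← part_eq_part_iff]
  refine ((refineBy_part P a).1 ?_).1
  rw [Finpartition.part_eq_of_mem _ hA hi, Finpartition.part_eq_of_mem _ hA hj]

/-- The vectors that cut the blocks of `P` into the blocks of `Q` correspond to the families of
embeddings of the sets of blocks of `Q` in a given block of `P`. -/
noncomputable def refineByEquiv {P Q : Finpartition (univ : Finset (Fin N))} (hQ : Q ≤ P) :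
    {a : Fin N → β // refineBy P a = Q} ≃
      ∀ B : {B // B ∈ P.parts}, ({A // A ∈ Q.parts.filter fun A => A ⊆ B.1} ↪ β) where
  toFun a B :=
    ⟨fun A => a.1 (Q.nonempty_of_mem_parts (mem_filter.1 A.2).1).choose, by
      intro A A' h
      have hA := mem_filter.1 A.2
      have hA' := mem_filter.1 A'.2
      have h1 := (Q.nonempty_of_mem_parts hA.1).choose_spec
      have h2 := (Q.nonempty_of_mem_parts hA'.1).choose_spec
      have h3 := (refineBy_part P a.1).2 ⟨(P.part_eq_of_mem B.2 (hA.2 h1)).trans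
        (P.part_eq_of_mem B.2 (hA'.2 h2)).symm, h⟩
      rw [a.2, Q.part_eq_of_mem hA.1 h1, Q.part_eq_of_mem hA'.1 h2] at h3
      exact Subtype.ext h3⟩
  invFun φ :=
    ⟨fun i => φ ⟨P.part i, P.part_mem.2 (mem_univ _)⟩
        ⟨Q.part i, mem_filter.2 ⟨Q.part_mem.2 (mem_univ _), part_subset_of_le hQ i⟩⟩, by
      apply finpartition_ext_part
      intro i j
      rw [refineBy_part]
      have key : ∀ (k : Fin N) (B) (hB : B ∈ P.parts) (hk : P.part k = B),
          φ ⟨P.part k, P.part_mem.2 (mem_univ _)⟩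
            ⟨Q.part k, mem_filter.2 ⟨Q.part_mem.2 (mem_univ _), part_subset_of_le hQ k⟩⟩ =
          φ ⟨B, hB⟩ ⟨Q.part k, mem_filter.2
            ⟨Q.part_mem.2 (mem_univ _), hk ▸ part_subset_of_le hQ k⟩⟩ := by
        rintro k _ _ rfl; rfl
      constructor
      · rintro ⟨h1, h2⟩
        rw [key i _ (P.part_mem.2 (mem_univ j)) h1] at h2
        simpa using (φ _).injective h2
      · intro h
        have h1 : P.part i = P.part j := by
          rw [part_eq_part_iff]
          exact part_subset_of_le hQ i ((part_eq_part_iff Q).1 h)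
        refine ⟨h1, ?_⟩
        rw [key i _ (P.part_mem.2 (mem_univ j)) h1]
        congr 2⟩
  left_inv a := by
    apply Subtype.ext
    funext i
    have hi := (Q.nonempty_of_mem_parts (Q.part_mem.2 (mem_univ i))).choose_spec
    rw [← part_eq_part_iff] at hi
    have h := refineBy_part P a.1 (i := i)
      (j := (Q.nonempty_of_mem_parts (Q.part_mem.2 (mem_univ i))).choose)
    rw [a.2] at h
    exact (h.1 hi).2.symm
  right_inv φ := by
    funext B
    ext A
    have hA := mem_filter.1 A.2
    have h1 := (Q.nonempty_of_mem_parts hA.1).choose_spec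
    have hP := P.part_eq_of_mem B.2 (hA.2 h1)
    have hQ := Q.part_eq_of_mem hA.1 h1
    have key : ∀ (B' A') (hB' : B' ∈ P.parts) (hA' : A' ∈ Q.parts.filter fun A => A ⊆ B'),
        B' = B.1 → A' = A.1 → φ ⟨B', hB'⟩ ⟨A', hA'⟩ = φ B A := by
      rintro _ _ _ _ rfl rfl; rfl
    exact key _ _ _ _ hP hQ

theorem card_refineBy_eq [Fintype β] {P Q : Finpartition (univ : Finset (Fin N))} (hQ : Q ≤ P) :
    #{a : Fin N → β | refineBy P a = Q} =
      ∏ B ∈ P.parts, (Fintype.card β).descFactorial #(Q.parts.filter fun A => A ⊆ B) := by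
  rw [← Fintype.card_subtype, Fintype.card_congr (refineByEquiv hQ), Fintype.card_pi,
    ← prod_attach P.parts]
  refine prod_congr rfl fun B _ => ?_
  rw [Fintype.card_embedding_eq, Fintype.card_coe]

/-- `Q` refines `P` and splits every block of `P` with more than one element. -/
def IsSplit (P Q : Finpartition (univ : Finset (Fin N))) : Prop :=
  Q ≤ P ∧ ∀ B ∈ P.parts, 1 < #B → B ∉ Q.parts

theorem isSplit_refineBy {P : Finpartition (univ : Finset (Fin N))} {a : Fin N → β} :
    IsSplit P (refineBy P a) ↔
      ∀ B ∈ P.parts, 1 < #B → ¬ ∀ i ∈ B, ∀ j ∈ B, a i = a j := by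
  refine ⟨fun h B hB hB1 hc => h.2 B hB hB1 ?_, fun h => ⟨refineBy_le P a, fun B hB hB1 hB' => ?_⟩⟩
  · obtain ⟨i, hi⟩ := P.nonempty_of_mem_parts hB
    have : (refineBy P a).part i = B := by
      ext j
      rw [← part_eq_part_iff, refineBy_part, P.part_eq_of_mem hB hi, eq_comm (a := B),
        P.part_eq_iff_mem hB]
      exact ⟨fun h => h.1, fun h => ⟨h, hc i hi j h⟩⟩
    rw [← this]
    exact Finpartition.part_mem _ |>.2 (mem_univ _)
  · refine h B hB hB1 fun i hi j hj => ?_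
    refine ((refineBy_part P a).1 ?_).2
    rw [Finpartition.part_eq_of_mem _ hB' hi, Finpartition.part_eq_of_mem _ hB' hj]

end Counting

section Recursion

variable {K : Type*} [Field K] [ValuativeRel K] [TopologicalSpace K]
  [IsNonarchimedeanLocalField K] [MeasurableSpace K] [BorelSpace K] {N : ℕ}

attribute [local instance] secondCountableTopology t2Space

theorem measurableSet_res_eq (a : 𝓀[K]) : MeasurableSet {x : K | res x = a} := by
  have h1 : MeasurableSet {x : K | x ∈ 𝒪[K] ∧ res x = a} := by
    have : {x : K | x ∈ 𝒪[K] ∧ res x = a} = lift a +ᵥ uniformizer K • (𝒪[K] : Set K) := by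
      ext x
      simp only [Set.mem_ofPred_eq, integer_res_iff, Set.mem_vadd_set, Set.mem_smul_set,
        vadd_eq_add, smul_eq_mul, SetLike.mem_coe]
      constructor
      · rintro ⟨z, hz, h⟩
        exact ⟨_, ⟨z, hz, rfl⟩, h⟩
      · rintro ⟨_, ⟨z, hz, rfl⟩, h⟩
        exact ⟨z, hz, h⟩
    rw [this]
    exact (measurableSet_integer.const_smul₀ _).const_vadd _
  have h2 : {x : K | res x = a} = {x : K | x ∈ 𝒪[K] ∧ res x = a} ∪
      ((𝒪[K] : Set K)ᶜ ∩ {_x : K | (0 : 𝓀[K]) = a}) := by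
    ext x
    by_cases hx : x ∈ 𝒪[K]
    · simp [hx]
    · have : res x = 0 := by rw [res, dif_neg hx]
      simp [hx, this]
  rw [h2]
  exact h1.union (measurableSet_integer.compl.inter (MeasurableSet.const _))

theorem measurableSet_res_mem (A : Set (Fin N → 𝓀[K])) :
    MeasurableSet {x : Fin N → K | (fun i => res (x i)) ∈ A} := by
  have : {x : Fin N → K | (fun i => res (x i)) ∈ A} =
      ⋃ a ∈ A, ⋂ i, (fun x : Fin N → K => x i) ⁻¹' {y | res y = a i} := by
    ext x
    simp only [Set.mem_ofPred_eq, Set.mem_iUnion, Set.mem_iInter, Set.mem_preimage]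
    constructor
    · exact fun h => ⟨_, h, fun i => rfl⟩
    · rintro ⟨a, ha, h⟩
      rwa [show (fun i => res (x i)) = a from funext h]
  rw [this]
  exact MeasurableSet.biUnion (Set.to_countable A) fun a _ => MeasurableSet.iInter fun i =>
    measurable_pi_apply i (measurableSet_res_eq _)

variable (K) in
/-- The integral of the interaction over the integral points, scaled by the uniformizer. -/
noncomputable def scaledMoment (s : Fin N → Fin N → ℂ) (B : Finset (Fin N)) : ℂ :=
  (Nat.card 𝓀[K] : ℂ) ^ (-∑ p ∈ pairs B, s p.1 p.2) *
    ∫ x, interaction (K := K) s (pairs B) x ∂(cubeMeasure K N)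

theorem scaledMoment_eq_one (s : Fin N → Fin N → ℂ) {B : Finset (Fin N)} (hB : #B ≤ 1) :
    scaledMoment K s B = 1 := by
  simp [scaledMoment, pairs_eq_empty hB, interaction]

theorem setIntegral_interaction [Fintype 𝓀[K]] [DecidableEq 𝓀[K]] {s : Fin N → Fin N → ℂ}
    (P : Finpartition (univ : Finset (Fin N)))
    (hi : Integrable (interaction (K := K) s (blockPairs P)) (cubeMeasure K N))
    (A : Finset (Fin N → 𝓀[K])) :
    ∫ x in residueUnion (A : Set (Fin N → 𝓀[K])), interaction (K := K) s (blockPairs P) x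
      ∂(cubeMeasure K N) = ((Nat.card 𝓀[K] : ℂ)⁻¹) ^ N *
        ∑ a ∈ A, ∏ B ∈ (refineBy P a).parts, scaledMoment K s B := by
  rw [setIntegral_residueUnion A _ hi]
  congr 1
  refine sum_congr rfl fun a _ => ?_
  simp only [scaledMoment]
  rw [integral_interaction_lift, integral_interaction_blockPairs, prod_mul_distrib,
    ← cpow_finset_sum _ _ (natCast_card_ne_zero K), sum_neg_distrib, sum_blockPairs]

theorem integral_nonconstant [Fintype 𝓀[K]] [DecidableEq 𝓀[K]] {s : Fin N → Fin N → ℂ}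
    {B : Finset (Fin N)} (hB : B.Nonempty)
    (hi : Integrable (interaction (K := K) s (pairs B)) (cubeMeasure K N)) :
    ∫ x in residueUnion (((constantOn K B)ᶜ : Finset (Fin N → 𝓀[K])) : Set (Fin N → 𝓀[K])),
      interaction (K := K) s (pairs B) x ∂(cubeMeasure K N) =
      (1 - (Nat.card 𝓀[K] : ℂ) ^ (-branchExponent B s)) *
        ∫ x, interaction (K := K) s (pairs B) x ∂(cubeMeasure K N) := by
  have h1 : ∫ x in residueUnion ((constantOn K B : Finset (Fin N → 𝓀[K])) : Set (Fin N → 𝓀[K])),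
      interaction (K := K) s (pairs B) x ∂(cubeMeasure K N) =
      (Nat.card 𝓀[K] : ℂ) ^ (-branchExponent B s) *
        ∫ x, interaction (K := K) s (pairs B) x ∂(cubeMeasure K N) := by
    rw [setIntegral_residueUnion _ _ hi, ← card_constantOn_mul s hB, mul_assoc, mul_assoc,
      ← nsmul_eq_mul]
    congr 1
    apply sum_eq_card_nsmul
    intro a ha
    simp only [← blockPairs_isolate B]
    rw [integral_interaction_lift, refineBy_isolate ha]
  have h2 := integral_residueUnion_add (constantOn K B) hi
  rw [h1] at h2
  rw [← eq_sub_iff_add_eq'] at h2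
  rw [h2]; ring

theorem prod_scaledMoment_mul [Fintype 𝓀[K]] [DecidableEq 𝓀[K]] {s : Fin N → Fin N → ℂ}
    (hi : ∀ P : Finpartition (univ : Finset (Fin N)),
      Integrable (interaction (K := K) s (blockPairs P)) (cubeMeasure K N))
    (P : Finpartition (univ : Finset (Fin N))) [DecidablePred (IsSplit P)] :
    (∏ B ∈ P.parts with 1 < #B, (Nat.card 𝓀[K] : ℂ) ^ (∑ p ∈ pairs B, s p.1 p.2) *
      (1 - (Nat.card 𝓀[K] : ℂ) ^ (-branchExponent B s))) * ∏ B ∈ P.parts, scaledMoment K s B =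
      ((Nat.card 𝓀[K] : ℂ)⁻¹) ^ N * ∑ a : Fin N → 𝓀[K] with IsSplit P (refineBy P a),
        ∏ B ∈ (refineBy P a).parts, scaledMoment K s B := by
  classical
  let g : Finset (Fin N) → (Fin N → K) → ℂ := fun B x =>
    if 1 < #B → (fun i => res (x i)) ∉ constantOn K B then interaction (K := K) s (pairs B) x else 0
  have hgm : ∀ B ∈ P.parts, Measurable (g B) := by
    intro B _
    refine Measurable.ite ?_ (measurable_interaction s _) measurable_const
    exact measurableSet_res_mem {a | 1 < #B → a ∉ constantOn K B}
  have hgd : ∀ B ∈ P.parts, DependsOn (g B) ((id B : Finset (Fin N)) : Set (Fin N)) := by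
    intro B _ x y hxy
    simp only [g]
    have : (fun i => res (x i)) ∈ constantOn K B ↔ (fun i => res (y i)) ∈ constantOn K B := by
      simp only [constantOn, mem_filter, mem_univ, true_and]
      refine forall₂_congr fun i hi => forall₂_congr fun j hj => ?_
      rw [hxy i hi, hxy j hj]
    rw [dependsOn_interaction s B hxy]
    simp only [this]
  have hprod := integral_prod_of_dependsOn (ν := integerMeasure K) P.parts id P.disjoint g hgm hgd
  have hL : ∀ A : Finset (Fin N → 𝓀[K]), ∀ h h' : (Fin N → K) → ℂ,
      (∀ x ∈ cube K N, h x = if (fun i => res (x i)) ∈ A then h' x else 0) →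
      ∫ x, h x ∂(cubeMeasure K N) =
        ∫ x in residueUnion (A : Set (Fin N → 𝓀[K])), h' x ∂(cubeMeasure K N) := by
    intro A h h' hh
    rw [← integral_indicator (measurableSet_residueUnion A)]
    refine integral_congr_ae ?_
    filter_upwards [ae_mem_cube N] with x hx
    rw [hh x hx, Set.indicator_apply]
    refine if_congr ?_ rfl rfl
    exact ⟨fun h => ⟨hx, h⟩, fun h => h.2⟩
  have h1 : ∫ x, ∏ B ∈ P.parts, g B x ∂(cubeMeasure K N) = ((Nat.card 𝓀[K] : ℂ)⁻¹) ^ N *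
      ∑ a : Fin N → 𝓀[K] with IsSplit P (refineBy P a),
        ∏ B ∈ (refineBy P a).parts, scaledMoment K s B := by
    rw [← setIntegral_interaction P (hi P)]
    refine hL _ _ _ fun x _ => ?_
    simp only [mem_filter, mem_univ, true_and, isSplit_refineBy, g, interaction_blockPairs]
    split_ifs with h
    · refine prod_congr rfl fun B hB => ?_
      rw [if_pos]
      simpa [constantOn] using h B hB
    · push Not at h
      obtain ⟨B, hB, hB1, h⟩ := h
      refine prod_eq_zero hB (if_neg ?_)
      simp only [constantOn, mem_filter, mem_univ, true_and]
      exact fun h' => h' hB1 h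
  have h2 : ∀ B ∈ P.parts, ∫ x, g B x ∂(cubeMeasure K N) =
      (if 1 < #B then (Nat.card 𝓀[K] : ℂ) ^ (∑ p ∈ pairs B, s p.1 p.2) *
        (1 - (Nat.card 𝓀[K] : ℂ) ^ (-branchExponent B s)) else 1) * scaledMoment K s B := by
    intro B hB
    split_ifs with hB1
    · have hiB := hi (isolate B)
      rw [blockPairs_isolate] at hiB
      rw [hL ((constantOn K B)ᶜ) (g B) (interaction s (pairs B)),
        integral_nonconstant (P.nonempty_of_mem_parts hB) hiB, scaledMoment,
        Complex.cpow_neg _ (∑ p ∈ pairs B, s p.1 p.2)]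
      · have hne : (Nat.card 𝓀[K] : ℂ) ^ (∑ p ∈ pairs B, s p.1 p.2) ≠ 0 := by
          simp [Complex.cpow_eq_zero_iff]
        linear_combination (-(1 - (Nat.card 𝓀[K] : ℂ) ^ (-branchExponent B s)) *
          ∫ x, interaction (K := K) s (pairs B) x ∂(cubeMeasure K N)) * mul_inv_cancel₀ hne
      · intro x _
        simp only [g, hB1, true_implies, mem_compl]
    · have h0 : #B ≤ 1 := by omega
      have : g B = fun _ => 1 := by
        funext x
        simp [g, hB1, pairs_eq_empty h0, interaction]
      rw [this, scaledMoment_eq_one s h0]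
      simp
  rw [← h1, cubeMeasure, hprod, prod_filter, ← prod_mul_distrib]
  exact (prod_congr rfl h2).symm

end Recursion

section Step

variable {N : ℕ}

/-- The factor of a branch with exponent `e` and degree `d`. -/
noncomputable def branchFactor (q : ℕ) (s : Fin N → Fin N → ℂ) (B : Finset (Fin N)) (d : ℕ) : ℂ :=
  ((q - 1).descFactorial (d - 1) : ℂ) / ((q : ℂ) ^ branchExponent B s - 1)

/-- The product of the branch factors of the blocks of `P` that are split by `Q`. -/
noncomputable def stepFactor (q : ℕ) (s : Fin N → Fin N → ℂ)
    (P Q : Finpartition (univ : Finset (Fin N))) : ℂ :=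
  ∏ B ∈ P.parts with 1 < #B, branchFactor q s B #(Q.parts.filter fun A => A ⊆ B)

theorem cpow_sub_one_ne_zero {q : ℕ} (hq : 1 < q) {z : ℂ} (hz : 0 < z.re) :
    (q : ℂ) ^ z - 1 ≠ 0 := by
  intro h
  have h1 : ‖(q : ℂ) ^ z‖ = 1 := by rw [sub_eq_zero.1 h, norm_one]
  have hq' : (1 : ℝ) < q := by exact_mod_cast hq
  rw [← Complex.ofReal_natCast, Complex.norm_cpow_eq_rpow_re_of_pos (by linarith)] at h1
  exact (Real.one_lt_rpow hq' hz).ne' h1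

theorem one_le_card_filter_subset {P Q : Finpartition (univ : Finset (Fin N))} (hQ : Q ≤ P)
    {B : Finset (Fin N)} (hB : B ∈ P.parts) : 1 ≤ #(Q.parts.filter fun A => A ⊆ B) := by
  obtain ⟨i, hi⟩ := P.nonempty_of_mem_parts hB
  rw [Nat.one_le_iff_ne_zero, card_ne_zero]
  refine ⟨Q.part i, mem_filter.2 ⟨Q.part_mem.2 (mem_univ _), ?_⟩⟩
  rw [← P.part_eq_of_mem hB hi]
  exact part_subset_of_le hQ i

theorem card_filter_subset_of_card_le_one {P Q : Finpartition (univ : Finset (Fin N))} (hQ : Q ≤ P)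
    {B : Finset (Fin N)} (hB : B ∈ P.parts) (h : #B ≤ 1) :
    #(Q.parts.filter fun A => A ⊆ B) = 1 := by
  refine le_antisymm ?_ (one_le_card_filter_subset hQ hB)
  rw [card_le_one]
  have key : ∀ A ∈ Q.parts.filter (fun A => A ⊆ B), A = B := by
    intro A hA
    rw [mem_filter] at hA
    refine eq_of_subset_of_card_le hA.2 (h.trans ?_)
    exact card_pos.2 (Q.nonempty_of_mem_parts hA.1)
  exact fun A hA A' hA' => (key A hA).trans (key A' hA').symm

theorem inv_pow_mul_card_refineBy {q : ℕ} (hq : 1 < q) {s : Fin N → Fin N → ℂ}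
    (hs : ∀ B : Finset (Fin N), 1 < #B → 0 < (branchExponent B s).re)
    {P Q : Finpartition (univ : Finset (Fin N))} (hQ : Q ≤ P) :
    ((q : ℂ)⁻¹) ^ N * (∏ B ∈ P.parts, q.descFactorial #(Q.parts.filter fun A => A ⊆ B) : ℕ) =
      (∏ B ∈ P.parts with 1 < #B, (q : ℂ) ^ (∑ p ∈ pairs B, s p.1 p.2) *
        (1 - (q : ℂ) ^ (-branchExponent B s))) * stepFactor q s P Q := by
  have hq0 : (q : ℂ) ≠ 0 := by exact_mod_cast (by omega : q ≠ 0)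
  have hN : ((q : ℂ)⁻¹) ^ N = ∏ B ∈ P.parts, ((q : ℂ)⁻¹) ^ #B := by
    rw [prod_pow_eq_pow_sum, P.sum_card_parts, card_univ, Fintype.card_fin]
  rw [hN, Nat.cast_prod, ← prod_mul_distrib, stepFactor, ← prod_mul_distrib, prod_filter]
  refine prod_congr rfl fun B hB => ?_
  obtain ⟨q', rfl⟩ : ∃ q', q = q' + 1 := ⟨q - 1, by omega⟩
  split_ifs with hB1
  · obtain ⟨d, hd⟩ : ∃ d, #(Q.parts.filter fun A => A ⊆ B) = d + 1 :=
      ⟨_, (Nat.sub_add_cancel (one_le_card_filter_subset hQ hB)).symm⟩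
    rw [hd, Nat.succ_descFactorial_succ, branchFactor, Nat.add_sub_cancel, Nat.add_sub_cancel]
    have hY := cpow_sub_one_ne_zero hq (hs B hB1)
    have hY0 : ((q' + 1 : ℕ) : ℂ) ^ branchExponent B s ≠ 0 := by
      intro h
      exact hq0 ((Complex.cpow_eq_zero_iff _ _).1 h).1
    have hsum : ((q' + 1 : ℕ) : ℂ) ^ (∑ p ∈ pairs B, s p.1 p.2) =
        ((q' + 1 : ℕ) : ℂ) ^ branchExponent B s * (((q' + 1 : ℕ) : ℂ) ^ #B)⁻¹ *
          ((q' + 1 : ℕ) : ℂ) := by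
      have : ∑ p ∈ pairs B, s p.1 p.2 = branchExponent B s + -(#B : ℂ) + 1 := by
        rw [branchExponent]; ring
      rw [this, Complex.cpow_add _ _ hq0, Complex.cpow_add _ _ hq0, Complex.cpow_neg _ (#B : ℂ),
        Complex.cpow_natCast, Complex.cpow_one]
    rw [hsum, Complex.cpow_neg, Nat.cast_mul]
    generalize ((q' + 1 : ℕ) : ℂ) ^ branchExponent B s = Y at *
    generalize ((q' + 1 : ℕ) : ℂ) = r at *
    rw [inv_pow]
    field_simp
  · have h1 : #B = 1 := le_antisymm (by omega) (card_pos.2 (P.nonempty_of_mem_parts hB))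
    rw [card_filter_subset_of_card_le_one hQ hB h1.le, h1]
    simp [Nat.descFactorial]
    push_cast at hq0
    exact inv_mul_cancel₀ hq0

variable {K : Type*} [Field K] [ValuativeRel K] [TopologicalSpace K]
  [IsNonarchimedeanLocalField K] [MeasurableSpace K] [BorelSpace K]

theorem prod_scaledMoment_eq_sum {s : Fin N → Fin N → ℂ}
    (hs : ∀ B : Finset (Fin N), 1 < #B → 0 < (branchExponent B s).re)
    (hi : ∀ P : Finpartition (univ : Finset (Fin N)),
      Integrable (interaction (K := K) s (blockPairs P)) (cubeMeasure K N))
    (P : Finpartition (univ : Finset (Fin N))) [DecidablePred (IsSplit P)] :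
    ∏ B ∈ P.parts, scaledMoment K s B = ∑ Q with IsSplit P Q,
      stepFactor (Nat.card 𝓀[K]) s P Q * ∏ A ∈ Q.parts, scaledMoment K s A := by
  classical
  have := Fintype.ofFinite 𝓀[K]
  have hq := one_lt_card_residue K
  have hc : (∏ B ∈ P.parts with 1 < #B, (Nat.card 𝓀[K] : ℂ) ^ (∑ p ∈ pairs B, s p.1 p.2) *
      (1 - (Nat.card 𝓀[K] : ℂ) ^ (-branchExponent B s))) ≠ 0 := by
    refine prod_ne_zero_iff.2 fun B hB => mul_ne_zero ?_ ?_
    · intro h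
      exact natCast_card_ne_zero K ((Complex.cpow_eq_zero_iff _ _).1 h).1
    · have h1 := cpow_sub_one_ne_zero hq (hs B (mem_filter.1 hB).2)
      intro h
      apply h1
      rw [sub_eq_zero, Complex.cpow_neg] at h
      rw [inv_injective (h.symm.trans inv_one.symm), sub_self]
  refine mul_left_cancel₀ hc ?_
  rw [prod_scaledMoment_mul hi P, mul_sum, mul_sum]
  rw [← sum_fiberwise_of_maps_to (s := {a : Fin N → 𝓀[K] | IsSplit P (refineBy P a)})
    (t := {Q | IsSplit P Q}) (g := fun a => refineBy P a) (fun a ha => by simpa using ha)]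
  refine sum_congr rfl fun Q hQ => ?_
  rw [mem_filter] at hQ
  rw [← mul_assoc, ← inv_pow_mul_card_refineBy hq hs hQ.2.1, Nat.card_eq_fintype_card,
    ← card_refineBy_eq hQ.2.1, filter_filter]
  rw [sum_congr (g := fun _ => ((Fintype.card 𝓀[K] : ℂ)⁻¹) ^ N * ∏ A ∈ Q.parts, scaledMoment K s A)
    (s₂ := {a : Fin N → 𝓀[K] | refineBy P a = Q}), sum_const, nsmul_eq_mul]
  · ring
  · ext a
    simp only [mem_filter, mem_univ, true_and]
    exact ⟨fun h => h.2, fun h => ⟨h ▸ hQ.2, h⟩⟩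
  · intro a ha
    rw [mem_filter] at ha
    rw [ha.2]

end Step

section Paths

variable {X : Type*} [Fintype X] [DecidableEq X]

theorem pow_mulVec_eq_sum_paths (W : Matrix X X ℂ) (e : X → ℂ) (L : ℕ) (P : X) :
    ((W ^ L).mulVec e) P = ∑ p : Fin (L + 1) → X with p 0 = P,
      (∏ l : Fin L, W (p l.castSucc) (p l.succ)) * e (p (Fin.last L)) := by
  induction L generalizing P with
  | zero =>
    rw [pow_zero, Matrix.one_mulVec, sum_filter,
      ← (Equiv.funUnique (Fin 1) X).symm.sum_comp]
    simp
  | succ L ih =>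
    rw [pow_succ', ← Matrix.mulVec_mulVec, Matrix.mulVec, dotProduct, sum_filter,
      ← (Fin.consEquiv fun _ : Fin (L + 2) => X).sum_comp, Fintype.sum_prod_type]
    refine Eq.trans ?_ (sum_eq_single_of_mem P (mem_univ _) ?_).symm
    · simp only [ih, mul_sum]
      rw [← sum_fiberwise (s := (univ : Finset (Fin (L + 1) → X))) (g := fun p => p 0)]
      refine sum_congr rfl fun Q _ => sum_congr rfl fun p hp => ?_
      rw [mem_filter] at hp
      simp only [Fin.consEquiv_apply, Fin.cons_zero, if_true]
      rw [Fin.prod_univ_succ, ← Fin.succ_last]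
      simp only [Fin.castSucc_zero, Fin.cons_zero, Fin.cons_succ, Fin.castSucc_succ]
      rw [hp.2, mul_assoc]
    · intro Q _ hQ
      refine sum_eq_zero fun p _ => ?_
      simp [Fin.consEquiv_apply, hQ]

theorem eq_sum_pow_mulVec (W : Matrix X X ℂ) (e v : X → ℂ) (h : v = W.mulVec v + e) (M : ℕ) :
    v = ∑ L ∈ range M, (W ^ L).mulVec e + (W ^ M).mulVec v := by
  induction M with
  | zero => simp
  | succ M ih =>
    rw [sum_range_succ, pow_succ, ← Matrix.mulVec_mulVec, add_assoc, ← Matrix.mulVec_add,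
      add_comm e, ← h]
    exact ih

end Paths

section Filtrations

variable {N : ℕ}

theorem eq_bot_iff_card_le_one {Q : Finpartition (univ : Finset (Fin N))} :
    Q = ⊥ ↔ ∀ B ∈ Q.parts, #B ≤ 1 := by
  constructor
  · rintro rfl B hB
    obtain ⟨i, -, rfl⟩ := Finpartition.mem_bot_iff.1 hB
    simp
  · intro h
    refine le_antisymm ?_ bot_le
    intro B hB
    obtain ⟨i, hi⟩ := card_eq_one.1 (le_antisymm (h B hB) (card_pos.2 (Q.nonempty_of_mem_parts hB)))
    exact ⟨{i}, Finpartition.mem_bot_iff.2 ⟨i, mem_univ _, rfl⟩, hi.subset⟩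

theorem parts_eq_image_singleton_iff {Q : Finpartition (univ : Finset (Fin N))} :
    (Q.parts = univ.image fun i => {i}) ↔ Q = ⊥ := by
  rw [Finpartition.ext_iff]
  have : (⊥ : Finpartition (univ : Finset (Fin N))).parts = univ.image fun i => {i} := by
    ext B
    rw [Finpartition.mem_bot_iff, mem_image]
  rw [this]

theorem IsSplit.lt {P Q : Finpartition (univ : Finset (Fin N))} (h : IsSplit P Q) (hP : P ≠ ⊥) :
    Q < P := by
  refine lt_of_le_of_ne h.1 ?_
  rintro rfl
  refine hP (eq_bot_iff_card_le_one.2 fun B hB => ?_)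
  by_contra hB1
  exact h.2 B hB (by omega) hB

namespace SplittingFiltration

theorem level_ne_bot (S : SplittingFiltration N) (l : Fin S.length) : S.level l.castSucc ≠ ⊥ := by
  intro h
  have := S.strictAnti (Fin.castSucc_lt_succ (i := l))
  rw [h] at this
  exact not_lt_bot this

theorem isReduced_iff (S : SplittingFiltration N) :
    S.IsReduced ↔ ∀ l : Fin S.length, IsSplit (S.level l.castSucc) (S.level l.succ) := by
  constructor
  · intro h l
    refine ⟨(S.strictAnti (Fin.castSucc_lt_succ (i := l))).le, fun B hB hB1 hB' => ?_⟩
    have hmem : B ∈ S.branches := mem_filter.2 ⟨mem_univ _, hB1, l, hB⟩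
    have hu := fun l' hl' => (h B hmem).unique (y₂ := l') hB hl'
    by_cases hl : (l : ℕ) + 1 < S.length
    · have h1 : (⟨l + 1, hl⟩ : Fin S.length).castSucc = l.succ := Fin.ext (by simp)
      have := hu ⟨l + 1, hl⟩ (by rw [h1]; exact hB')
      exact absurd (congrArg Fin.val this) (by simp)
    · have h1 : l.succ = Fin.last S.length := Fin.ext (by simp; omega)
      rw [h1, S.level_last, mem_image] at hB'
      obtain ⟨i, -, rfl⟩ := hB'
      simp at hB1
  · intro h B hB
    obtain ⟨-, hB1, l, hl⟩ := mem_filter.1 hB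
    refine ⟨l, hl, fun l' hl' => ?_⟩
    have key : ∀ l l' : Fin S.length, B ∈ (S.level l.castSucc).parts →
        B ∈ (S.level l'.castSucc).parts → ¬ l < l' := by
      intro l l' hl hl' hlt
      refine (h l).2 B hl hB1 ?_
      obtain ⟨C, hC, hBC⟩ := S.strictAnti.antitone
        (show l.succ ≤ l'.castSucc from Fin.succ_le_castSucc_iff.2 hlt) hl'
      obtain ⟨D, hD, hCD⟩ := (h l).1 hC
      obtain ⟨i, hi⟩ := Finpartition.nonempty_of_mem_parts _ hl
      have : B = D := Finpartition.eq_of_mem_parts _ hl hD hi (hCD (hBC hi))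
      have : B = C := Subset.antisymm hBC (this ▸ hCD)
      rwa [this]
    exact le_antisymm (not_lt.1 (key l l' hl hl')) (not_lt.1 (key l' l hl' hl))

theorem IsReduced.depth_eq {S : SplittingFiltration N} (h : S.IsReduced) {B : Finset (Fin N)}
    (hB1 : 1 < #B) {l : Fin S.length} (hl : B ∈ (S.level l.castSucc).parts) : S.depth B = l := by
  have hu := fun l' hl' => (h B (mem_filter.2 ⟨mem_univ _, hB1, l, hl⟩)).unique (y₂ := l') hl hl'
  have : (univ.filter fun l : Fin S.length => B ∈ (S.level l.castSucc).parts) = {l} := by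
    ext l'
    simp only [mem_filter, mem_univ, true_and, mem_singleton]
    exact ⟨fun h => (hu _ h).symm, fun h => h ▸ hl⟩
  rw [depth, this, sup_singleton]

theorem IsReduced.degree_eq {S : SplittingFiltration N} (h : S.IsReduced) {B : Finset (Fin N)}
    (hB1 : 1 < #B) {l : Fin S.length} (hl : B ∈ (S.level l.castSucc).parts) :
    S.degree B = #((S.level l.succ).parts.filter fun A => A ⊆ B) := by
  have : S.levelAt (S.depth B + 1) = S.level l.succ := by
    rw [h.depth_eq hB1 hl, levelAt]
    congr 1
    ext
    simp
  rw [degree, this]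

theorem IsReduced.prod_branches {S : SplittingFiltration N} (h : S.IsReduced) {M : Type*}
    [CommMonoid M] (φ : Finset (Fin N) → ℕ → M) :
    ∏ B ∈ S.branches, φ B (S.degree B) = ∏ l : Fin S.length,
      ∏ B ∈ (S.level l.castSucc).parts with 1 < #B,
        φ B #((S.level l.succ).parts.filter fun A => A ⊆ B) := by
  have hb : S.branches = univ.biUnion fun l : Fin S.length =>
      (S.level l.castSucc).parts.filter fun B => 1 < #B := by
    ext B
    simp only [branches, mem_filter, mem_univ, true_and, mem_biUnion]
    exact ⟨fun ⟨h1, l, hl⟩ => ⟨l, hl, h1⟩, fun ⟨l, hl, h1⟩ => ⟨h1, l, hl⟩⟩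
  rw [hb, prod_biUnion]
  · refine prod_congr rfl fun l _ => prod_congr rfl fun B hB => ?_
    rw [mem_filter] at hB
    rw [h.degree_eq hB.2 hB.1]
  · intro l _ l' _ hll
    rw [Function.onFun, disjoint_left]
    intro B hB hB'
    rw [mem_filter] at hB hB'
    exact hll ((h B (mem_filter.2 ⟨mem_univ _, hB.2, l, hB.1⟩)).unique hB.1 hB'.1)

end SplittingFiltration

open Classical in
/-- The sum over the reduced splitting filtrations solves the recursion for the one-block
partition. -/
theorem eq_sum_reduced (q : ℕ) (s : Fin N → Fin N → ℂ)
    (v : Finpartition (univ : Finset (Fin N)) → ℂ) (hbot : v ⊥ = 1)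
    (hv : ∀ P, P ≠ ⊥ → v P = ∑ Q with IsSplit P Q, stepFactor q s P Q * v Q)
    (T : Finpartition (univ : Finset (Fin N))) (hT : T.parts = {univ}) :
    v T = ∑ S : SplittingFiltration N with S.IsReduced,
      ∏ B ∈ S.branches, branchFactor q s B (S.degree B) := by
  let X := Finpartition (univ : Finset (Fin N))
  let W : Matrix X X ℂ := fun P Q => if P ≠ ⊥ ∧ IsSplit P Q then stepFactor q s P Q else 0
  let e : X → ℂ := fun P => if P = ⊥ then 1 else 0
  have hW : v = W.mulVec v + e := by
    funext P
    by_cases hP : P = ⊥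
    · simp [W, e, hP, hbot, Matrix.mulVec, dotProduct]
    · rw [hv P hP, sum_filter]
      simp [W, e, hP, Matrix.mulVec, dotProduct]
      rfl
  have hanti : ∀ (L : ℕ) (p : Fin (L + 1) → X),
      ∏ l : Fin L, W (p l.castSucc) (p l.succ) ≠ 0 → StrictAnti p := by
    intro L p hp
    refine Fin.strictAnti_iff_succ_lt.2 fun l => ?_
    have := prod_ne_zero_iff.1 hp l (mem_univ _)
    simp only [W, ne_eq, ite_eq_right_iff, not_forall] at this
    obtain ⟨h, -⟩ := this
    exact h.2.lt h.1
  have hcard : ∀ (L : ℕ) (p : Fin (L + 1) → X), StrictAnti p → L < Fintype.card X := by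
    intro L p hp
    have := Fintype.card_le_of_injective p hp.injective
    rwa [Fintype.card_fin] at this
  have h0 : (W ^ Fintype.card X).mulVec v = 0 := by
    funext P
    rw [pow_mulVec_eq_sum_paths]
    refine sum_eq_zero fun p _ => ?_
    by_contra h
    exact lt_irrefl _ (hcard _ p (hanti _ p (left_ne_zero_of_mul h)))
  have hmain := congrFun (eq_sum_pow_mulVec W e v hW (Fintype.card X)) T
  rw [h0, add_zero, Finset.sum_apply, ← Fin.sum_univ_eq_sum_range
    (fun L => ((W ^ L).mulVec e) T)] at hmain
  rw [hmain]
  simp only [pow_mulVec_eq_sum_paths, sum_filter (s := (univ : Finset (Fin _ → X)))]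
  rw [← Fintype.sum_sigma' (fun (L : Fin (Fintype.card X)) (p : Fin ((L : ℕ) + 1) → X) =>
    if p 0 = T then (∏ l : Fin L, W (p l.castSucc) (p l.succ)) * e (p (Fin.last L)) else 0)]
  symm
  refine sum_of_injOn (fun S : SplittingFiltration N =>
    (⟨⟨S.length, hcard _ _ S.strictAnti⟩, S.level⟩ :
      Σ L : Fin (Fintype.card X), (Fin ((L : ℕ) + 1) → X))) ?_ (fun _ _ => mem_coe.2 (mem_univ _)) ?_ ?_
  · rintro ⟨L, l, _, _, _⟩ - ⟨L', l', _, _, _⟩ - h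
    simp only [Sigma.mk.injEq, Fin.mk.injEq] at h
    obtain ⟨rfl, h⟩ := h
    simp only [heq_eq_eq] at h
    subst h
    rfl
  · rintro ⟨L, p⟩ - hp
    by_contra hne
    simp only [ite_eq_right_iff, not_forall] at hne
    obtain ⟨hp0, hne⟩ := hne
    have hlast : p (Fin.last L) = ⊥ := by
      by_contra h
      exact right_ne_zero_of_mul hne (if_neg h)
    have hstep := left_ne_zero_of_mul hne
    refine hp ⟨⟨L, p, by rw [hp0, hT], parts_eq_image_singleton_iff.2 hlast, hanti _ p hstep⟩,
      ?_, rfl⟩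
    rw [mem_coe, mem_filter]
    refine ⟨mem_univ _, (SplittingFiltration.isReduced_iff _).2 fun l => ?_⟩
    have := prod_ne_zero_iff.1 hstep l (mem_univ _)
    simp only [W, ne_eq, ite_eq_right_iff, not_forall] at this
    exact this.1.2
  · intro S hS
    have hred : S.IsReduced := (mem_filter.1 hS).2
    have hS0 : S.level 0 = T := Finpartition.ext (S.level_zero.trans hT.symm)
    have hSl : S.level (Fin.last S.length) = ⊥ := parts_eq_image_singleton_iff.1 S.level_last
    rw [hred.prod_branches (fun B d => branchFactor q s B d)]
    simp only [hS0, if_true, e, hSl, mul_one]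
    refine prod_congr rfl fun l _ => ?_
    simp only [W]
    rw [if_pos ⟨S.level_ne_bot l, (S.isReduced_iff.1 hred) l⟩, stepFactor]

end Filtrations

section Identity

variable {K : Type*} [Field K] [ValuativeRel K] [TopologicalSpace K]
  [IsNonarchimedeanLocalField K] [MeasurableSpace K] [BorelSpace K] {N : ℕ}

theorem univ_mem_branches (hN : 2 ≤ N) (S : SplittingFiltration N) :
    (univ : Finset (Fin N)) ∈ S.branches := by
  have hc : #(univ : Finset (Fin N)) = N := by simp
  refine mem_filter.2 ⟨mem_univ _, by omega, ?_⟩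
  have hL : 0 < S.length := by
    by_contra h
    have h0 : (0 : Fin (S.length + 1)) = Fin.last S.length := Fin.ext (by simp; omega)
    have h1 := S.level_last
    rw [← h0, S.level_zero] at h1
    have : (univ : Finset (Fin N)) ∈ (univ : Finset (Fin N)).image fun i => ({i} : Finset (Fin N)) := by
      rw [← h1]; exact mem_singleton_self _
    obtain ⟨i, -, hi⟩ := mem_image.1 this
    rw [← hi, card_singleton] at hc
    omega
  refine ⟨⟨0, hL⟩, ?_⟩
  have : (⟨0, hL⟩ : Fin S.length).castSucc = 0 := Fin.ext (by simp)
  rw [this, S.level_zero]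
  exact mem_singleton_self _

theorem sum_branchFunction (hN : 2 ≤ N) {s : Fin N → Fin N → ℂ}
    (hs : ∀ B : Finset (Fin N), 1 < #B → 0 < (branchExponent B s).re)
    (hi : ∀ P : Finpartition (univ : Finset (Fin N)),
      Integrable (interaction (K := K) s (blockPairs P)) (cubeMeasure K N)) :
    ∑ S ∈ admissible N (Nat.card 𝓀[K]), branchFunction S (Nat.card 𝓀[K]) s =
      (1 - (Nat.card 𝓀[K] : ℂ) ^ (-branchExponent univ s)) *
        ∫ x, interaction (K := K) s (pairs univ) x ∂(cubeMeasure K N) := by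
  classical
  have hc : #(univ : Finset (Fin N)) = N := by simp
  have hq0 := natCast_card_ne_zero K
  have hY := cpow_sub_one_ne_zero (one_lt_card_residue K) (hs univ (by omega))
  have hY0 : (Nat.card 𝓀[K] : ℂ) ^ branchExponent univ s ≠ 0 := fun h =>
    hq0 ((Complex.cpow_eq_zero_iff _ _).1 h).1
  have hne : (univ : Finset (Fin N)) ≠ ⊥ := by
    intro h
    rw [h] at hc
    simp at hc
    omega
  let T : Finpartition (univ : Finset (Fin N)) := Finpartition.indiscrete hne
  have hT : T.parts = {univ} := rfl
  have h1 := eq_sum_reduced (Nat.card 𝓀[K]) s (fun P => ∏ B ∈ P.parts, scaledMoment K s B)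
    (prod_eq_one fun B hB => scaledMoment_eq_one s (eq_bot_iff_card_le_one.1 rfl B hB))
    (fun P _ => prod_scaledMoment_eq_sum hs hi P) T hT
  simp only [hT, prod_singleton, scaledMoment] at h1
  have h2 : ∀ S : SplittingFiltration N, branchFunction S (Nat.card 𝓀[K]) s =
      ((Nat.card 𝓀[K] : ℂ) ^ branchExponent univ s - 1) / (Nat.card 𝓀[K] : ℂ) ^ (N - 1) *
        ∏ B ∈ S.branches, branchFactor (Nat.card 𝓀[K]) s B (S.degree B) := by
    intro S
    simp only [branchFactor]
    rw [prod_div_distrib, ← mul_prod_erase S.branches (fun B => ((Nat.card 𝓀[K] : ℂ) ^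
      branchExponent B s - 1)) (univ_mem_branches hN S), branchFunction,
      SplittingFiltration.multiplicity, Nat.cast_prod]
    simp only [one_div, prod_inv_distrib]
    field_simp
  have h3 : ∑ S ∈ admissible N (Nat.card 𝓀[K]), branchFunction S (Nat.card 𝓀[K]) s =
      ∑ S : SplittingFiltration N with S.IsReduced, branchFunction S (Nat.card 𝓀[K]) s := by
    refine sum_subset ?_ ?_
    · intro S hS
      exact mem_filter.2 ⟨mem_univ _, (mem_filter.1 hS).2.1⟩
    · intro S hS hS'
      have hm : S.multiplicity (Nat.card 𝓀[K]) = 0 := by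
        by_contra hm
        exact hS' (mem_filter.2 ⟨mem_univ _, (mem_filter.1 hS).2, Nat.pos_of_ne_zero hm⟩)
      simp [branchFunction, hm]
  rw [h3, sum_congr rfl fun S _ => h2 S, ← mul_sum, ← h1, ← mul_assoc]
  congr 1
  have hsum : (Nat.card 𝓀[K] : ℂ) ^ (-∑ p ∈ pairs univ, s p.1 p.2) =
      ((Nat.card 𝓀[K] : ℂ) ^ branchExponent univ s)⁻¹ * (Nat.card 𝓀[K] : ℂ) ^ (N - 1) := by
    have : -∑ p ∈ pairs univ, s p.1 p.2 = -branchExponent univ s + (N - 1 : ℕ) := by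
      rw [branchExponent, hc, Nat.cast_sub (by omega)]
      push_cast; ring
    rw [this, Complex.cpow_add _ _ hq0, Complex.cpow_neg, Complex.cpow_natCast]
  rw [hsum, Complex.cpow_neg]
  field_simp

end Identity

section Growth

theorem eventually_norm_le_rpow {u : ℕ → ℂ} {c : ℝ}
    (h : limsup (fun n : ℕ => ENNReal.log ‖u n‖ₑ / (Real.log n : EReal)) atTop < c) :
    ∀ᶠ n : ℕ in atTop, ‖u n‖ ≤ (n : ℝ) ^ c := by
  filter_upwards [eventually_lt_of_limsup_lt h, eventually_ge_atTop 2] with n hn hn2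
  have hn1 : (1 : ℝ) < n := by exact_mod_cast hn2
  have hlog : (0 : EReal) < (Real.log n : EReal) := by exact_mod_cast Real.log_pos hn1
  have h1 := (EReal.div_le_iff_le_mul hlog (EReal.coe_ne_top _)).1 hn.le
  have hpos : 0 < (n : ℝ) ^ c := Real.rpow_pos_of_pos (by linarith) c
  have h2 : ENNReal.log ‖u n‖ₑ ≤ ENNReal.log (ENNReal.ofReal ((n : ℝ) ^ c)) := by
    rw [ENNReal.log_ofReal_of_pos hpos, Real.log_rpow (by linarith)]
    refine h1.trans (le_of_eq ?_)
    rw [mul_comm c]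
    push_cast
    rfl
  rw [ENNReal.log_le_log_iff, ← ofReal_norm, ENNReal.ofReal_le_ofReal_iff hpos.le] at h2
  exact h2

theorem summable_rootTerm {ρ : ℝ → ℂ} (hρ : HasAdmissibleGrowth ρ) {q : ℕ} (hq : 1 < q) {z : ℂ}
    (hz : 1 < z.re) : Summable (rootTerm q ρ z) := by
  have hq' : (1 : ℝ) < q := by exact_mod_cast hq
  have hq0 : (0 : ℝ) < q := by linarith
  have hpow : Tendsto (fun n : ℕ => q ^ n) atTop atTop := tendsto_pow_atTop_atTop_of_one_lt hq
  have hrp : ∀ (y : ℝ) (n : ℕ), (((q ^ n : ℕ) : ℝ)) ^ y = ((q : ℝ) ^ y) ^ n := by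
    intro y n
    push_cast
    rw [← Real.rpow_natCast, ← Real.rpow_mul hq0.le, mul_comm, Real.rpow_mul hq0.le,
      Real.rpow_natCast]
  have hnorm : ∀ m : ℤ, ‖(q : ℂ) ^ ((m : ℂ) * z)‖ = (q : ℝ) ^ ((m : ℝ) * z.re) := by
    intro m
    rw [← Complex.ofReal_natCast, Complex.norm_cpow_eq_rpow_re_of_pos hq0]
    simp
  refine Summable.of_nat_of_neg ?_ ?_
  · have h1 : limsup (fun n : ℕ => ENNReal.log ‖ρ (n : ℝ)‖ₑ / (Real.log n : EReal)) atTop <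
        ((-z.re - 1 : ℝ) : EReal) := by
      rw [hρ.2]; exact EReal.bot_lt_coe _
    have h2 := hpow.eventually (eventually_norm_le_rpow h1)
    refine Summable.of_norm_bounded_eventually_nat (g := fun n : ℕ => ((q : ℝ) ^ (-1 : ℝ)) ^ n)
      (summable_geometric_of_lt_one (by positivity)
        (Real.rpow_lt_one_of_one_lt_of_neg hq' (by norm_num))) ?_
    filter_upwards [h2] with n hn
    rw [rootTerm, norm_mul, hnorm]
    have e1 : (q : ℝ) ^ ((n : ℤ) : ℤ) = ((q ^ n : ℕ) : ℝ) := by push_cast; rw [zpow_natCast]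
    have e2 : (q : ℝ) ^ ((((n : ℤ) : ℤ) : ℝ) * z.re) = ((q ^ n : ℕ) : ℝ) ^ z.re := by
      rw [hrp, Int.cast_natCast, mul_comm, Real.rpow_mul hq0.le, Real.rpow_natCast]
    rw [e1, e2, ← hrp]
    have hqn : (0 : ℝ) < ((q ^ n : ℕ) : ℝ) := by push_cast; positivity
    calc _ ≤ ((q ^ n : ℕ) : ℝ) ^ (-z.re - 1) * ((q ^ n : ℕ) : ℝ) ^ z.re :=
          mul_le_mul_of_nonneg_right hn (by positivity)
      _ = _ := by rw [← Real.rpow_add hqn]; ring_nf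
  · have h1 : limsup (fun n : ℕ => ENNReal.log ‖ρ (1 / (n : ℝ))‖ₑ / (Real.log n : EReal)) atTop <
        (((1 + z.re) / 2 : ℝ) : EReal) := by
      refine hρ.1.trans_lt ?_
      have : (1 : ℝ) < (1 + z.re) / 2 := by linarith
      exact_mod_cast this
    have h2 := hpow.eventually (eventually_norm_le_rpow h1)
    refine Summable.of_norm_bounded_eventually_nat
      (g := fun n : ℕ => ((q : ℝ) ^ ((1 - z.re) / 2)) ^ n)
      (summable_geometric_of_lt_one (by positivity)
        (Real.rpow_lt_one_of_one_lt_of_neg hq' (by linarith))) ?_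
    filter_upwards [h2] with n hn
    rw [rootTerm, norm_mul, hnorm]
    have e1 : (q : ℝ) ^ (-(n : ℤ)) = 1 / ((q ^ n : ℕ) : ℝ) := by
      push_cast; rw [zpow_neg, zpow_natCast, one_div]
    have e2 : (q : ℝ) ^ (((-(n : ℤ) : ℤ) : ℝ) * z.re) = ((q ^ n : ℕ) : ℝ) ^ (-z.re) := by
      rw [hrp, ← Real.rpow_natCast, ← Real.rpow_mul hq0.le]
      push_cast
      ring_nf
    rw [e1, e2, ← hrp]
    have hqn : (0 : ℝ) < ((q ^ n : ℕ) : ℝ) := by push_cast; positivity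
    calc _ ≤ ((q ^ n : ℕ) : ℝ) ^ ((1 + z.re) / 2) * ((q ^ n : ℕ) : ℝ) ^ (-z.re) :=
          mul_le_mul_of_nonneg_right hn (by positivity)
      _ = _ := by rw [← Real.rpow_add hqn]; ring_nf

end Growth

section Shells

variable {K : Type*} [Field K] [ValuativeRel K] [TopologicalSpace K]
  [IsNonarchimedeanLocalField K] [MeasurableSpace K] [BorelSpace K] {N : ℕ}

attribute [local instance] secondCountableTopology t2Space

theorem canonicalAbs_le_maxNorm (x : Fin N → K) (i : Fin N) : canonicalAbs (x i) ≤ maxNorm x :=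
  le_ciSup (f := fun i => canonicalAbs (x i)) (Set.finite_range _).bddAbove i

theorem exists_canonicalAbs_eq_maxNorm (hN : 0 < N) (x : Fin N → K) :
    ∃ i, canonicalAbs (x i) = maxNorm x := by
  have : Nonempty (Fin N) := ⟨⟨0, hN⟩⟩
  exact exists_eq_ciSup_of_finite (f := fun i => canonicalAbs (x i))

theorem maxNorm_smul (c : K) (x : Fin N → K) :
    maxNorm (fun i => c * x i) = canonicalAbs c * maxNorm x := by
  rw [maxNorm, maxNorm, Real.mul_iSup_of_nonneg (canonicalAbs_nonneg c)]
  simp only [canonicalAbs_mul]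

variable (K) in
/-- The points whose norm is the `m`-th power of the residue cardinality. -/
def shell (N : ℕ) (m : ℤ) : Set (Fin N → K) := {x | maxNorm x = (Nat.card 𝓀[K] : ℝ) ^ m}

theorem res_zero : res (0 : K) = 0 := by
  rw [res, dif_pos (zero_mem _)]
  exact map_zero _

theorem shell_zero (hN : 0 < N) [Fintype 𝓀[K]] [DecidableEq 𝓀[K]] :
    shell K N 0 = residueUnion ((({0} : Finset (Fin N → 𝓀[K]))ᶜ : Finset (Fin N → 𝓀[K])) :
      Set (Fin N → 𝓀[K])) := by
  have hq : (1 : ℝ) < Nat.card 𝓀[K] := by exact_mod_cast one_lt_card_residue K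
  ext x
  simp only [shell, zpow_zero, residueUnion, Set.mem_ofPred_eq, coe_compl, coe_singleton,
    Set.mem_compl_iff, Set.mem_singleton_iff, cube]
  constructor
  · intro h
    have hx : ∀ i, x i ∈ 𝒪[K] := fun i =>
      mem_integer_iff_canonicalAbs_le_one.2 (h ▸ canonicalAbs_le_maxNorm x i)
    refine ⟨hx, fun h0 => ?_⟩
    obtain ⟨i, hi⟩ := exists_canonicalAbs_eq_maxNorm hN x
    have h1 : res (x i) = res (0 : K) := by rw [res_zero]; exact congrFun h0 i
    obtain ⟨z, hz, hxz⟩ := (res_eq_iff (hx i) (zero_mem _)).1 h1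
    have h2 := canonicalAbs_le_one hz
    rw [h, hxz, zero_add, canonicalAbs_mul, canonicalAbs_uniformizer] at hi
    have h3 := inv_lt_one_of_one_lt₀ hq
    have h4 : (0 : ℝ) < (Nat.card 𝓀[K] : ℝ)⁻¹ := by positivity
    nlinarith
  · rintro ⟨hx, h0⟩
    obtain ⟨j, hj⟩ := exists_canonicalAbs_eq_maxNorm hN x
    refine le_antisymm (hj ▸ canonicalAbs_le_one (hx j)) ?_
    obtain ⟨i, hi⟩ := Function.ne_iff.1 h0
    have h1 := canonicalAbs_sub_eq_one (hx i) (zero_mem _) (by rw [res_zero]; exact hi)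
    rw [sub_zero] at h1
    exact h1 ▸ canonicalAbs_le_maxNorm x i

theorem canonicalAbs_uniformizer_zpow (m : ℤ) :
    canonicalAbs (uniformizer K ^ (-m)) = (Nat.card 𝓀[K] : ℝ) ^ m := by
  rw [canonicalAbs_zpow, canonicalAbs_uniformizer, inv_zpow, zpow_neg, inv_inv]

theorem preimage_shell (m : ℤ) :
    affineMap (uniformizer K ^ (-m)) (zpow_ne_zero _ uniformizer_ne_zero) (0 : Fin N → K) ⁻¹'
      shell K N m = shell K N 0 := by
  have hq : (Nat.card 𝓀[K] : ℝ) ≠ 0 := by exact_mod_cast (Nat.card_pos (α := 𝓀[K])).ne'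
  ext x
  have : affineMap (uniformizer K ^ (-m)) (zpow_ne_zero _ uniformizer_ne_zero) (0 : Fin N → K) x =
      fun i => uniformizer K ^ (-m) * x i := by
    funext i
    rw [affineMap_apply, Pi.zero_apply, zero_add]
  rw [Set.mem_preimage, this]
  change maxNorm _ = _ ↔ maxNorm _ = _
  rw [maxNorm_smul, canonicalAbs_uniformizer_zpow, zpow_zero, mul_eq_left₀ (zpow_ne_zero _ hq)]

theorem measurableSet_shell (hN : 0 < N) (m : ℤ) : MeasurableSet (shell K N m) := by
  classical
  have := Fintype.ofFinite 𝓀[K]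
  rw [← (affineMap (uniformizer K ^ (-m)) (zpow_ne_zero _ uniformizer_ne_zero)
    (0 : Fin N → K)).measurableSet_preimage, preimage_shell, shell_zero hN]
  exact measurableSet_residueUnion _

theorem pairwise_disjoint_shell :
    Pairwise (Function.onFun Disjoint (shell K N)) := by
  have hq : (1 : ℝ) < Nat.card 𝓀[K] := by exact_mod_cast one_lt_card_residue K
  intro m m' h
  rw [Function.onFun, Set.disjoint_left]
  intro x hx hx'
  have h1 : maxNorm x = _ := hx
  have h2 : maxNorm x = _ := hx'
  exact h (zpow_right_injective₀ (by linarith) hq.ne' (h1.symm.trans h2))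

theorem iUnion_shell_ae (hN : 0 < N) : ∀ᵐ x ∂(productHaar K N), x ∈ ⋃ m, shell K N m := by
  have h0 : productHaar K N {0} = 0 := by
    have h1 : ({0} : Set (Fin N → K)) = Set.univ.pi fun _ => {0} := by
      ext x; simp [funext_iff]
    have h2 : normalizedHaar K {0} = 0 := by
      have h3 := canonicalAbs_zero (K := K)
      rw [canonicalAbs_eq, Set.zero_smul_set ⟨0, zero_mem _⟩, ENNReal.toReal_eq_zero_iff] at h3
      refine h3.resolve_right (ne_top_of_le_ne_top (b := normalizedHaar K (𝒪[K] : Set K)) ?_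
        (measure_mono ?_))
      · rw [normalizedHaar_integer]; simp
      · rintro _ rfl; exact zero_mem _
    rw [h1, productHaar, Measure.pi_pi]
    exact prod_eq_zero (mem_univ ⟨0, hN⟩) h2
  rw [ae_iff]
  refine measure_mono_null ?_ h0
  intro x hx
  by_contra hx0
  apply hx
  obtain ⟨i, hi⟩ := exists_canonicalAbs_eq_maxNorm hN x
  have hxi : x i ≠ 0 := by
    intro h
    rw [h, canonicalAbs_zero] at hi
    apply hx0
    rw [Set.mem_singleton_iff]
    funext j
    have h1 := canonicalAbs_le_maxNorm x j
    rw [← hi] at h1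
    exact canonicalAbs_eq_zero.1 (le_antisymm h1 (canonicalAbs_nonneg _))
  obtain ⟨m, hm⟩ := exists_canonicalAbs_eq_zpow hxi
  exact Set.mem_iUnion.2 ⟨m, hi.symm.trans hm⟩

theorem restrict_shell (hN : 0 < N) (m : ℤ) :
    (productHaar K N).restrict (shell K N m) =
      ENNReal.ofReal ((Nat.card 𝓀[K] : ℝ) ^ m) ^ N •
        ((cubeMeasure K N).restrict (shell K N 0)).map
          (affineMap (uniformizer K ^ (-m)) (zpow_ne_zero _ uniformizer_ne_zero) 0) := by
  have hsub : shell K N 0 ⊆ cube K N := by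
    intro x hx i
    have hx : maxNorm x = _ := hx
    rw [zpow_zero] at hx
    exact mem_integer_iff_canonicalAbs_le_one.2 (hx ▸ canonicalAbs_le_maxNorm x i)
  rw [restrict_image_affineMap _ _ _ _ (preimage_shell m), canonicalAbs_uniformizer_zpow,
    cubeMeasure_eq, Measure.restrict_restrict (measurableSet_shell hN 0), Set.inter_eq_left.2 hsub]

theorem zpow_cpow {q : ℕ} (hq : 0 < q) (m : ℤ) (w : ℂ) :
    (((q : ℝ) ^ m : ℝ) : ℂ) ^ w = (q : ℂ) ^ ((m : ℂ) * w) := by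
  have hq0 : (0 : ℝ) < q := by exact_mod_cast hq
  have h1 : (((q : ℝ) ^ m : ℝ) : ℂ) ≠ 0 := by exact_mod_cast (zpow_pos hq0 m).ne'
  have h2 : (q : ℂ) ≠ 0 := by exact_mod_cast hq.ne'
  rw [Complex.cpow_def_of_ne_zero h1, Complex.cpow_def_of_ne_zero h2,
    ← Complex.ofReal_log (zpow_pos hq0 m).le, Real.log_zpow, ← Complex.natCast_log]
  push_cast
  ring_nf

theorem density_shell {ρ : ℝ → ℂ} {s : Fin N → Fin N → ℂ} (m : ℤ) {x : Fin N → K}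
    (hx : x ∈ shell K N 0) :
    (((Nat.card 𝓀[K] : ℝ) ^ m) ^ N : ℝ) • (fun x => ρ (maxNorm x) * interaction s (pairs univ) x)
      (affineMap (uniformizer K ^ (-m)) (zpow_ne_zero _ uniformizer_ne_zero) 0 x) =
      rootTerm (Nat.card 𝓀[K]) ρ (N + ∑ p ∈ pairs univ, s p.1 p.2) m *
        interaction s (pairs univ) x := by
  have hx : maxNorm x = _ := hx
  have hq := natCast_card_ne_zero K
  have : affineMap (uniformizer K ^ (-m)) (zpow_ne_zero _ uniformizer_ne_zero) (0 : Fin N → K) x =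
      fun i => uniformizer K ^ (-m) * x i := by
    funext i
    rw [affineMap_apply, Pi.zero_apply, zero_add]
  simp only [this]
  rw [maxNorm_smul, hx, zpow_zero, mul_one, interaction_smul _ _ (zpow_ne_zero _ uniformizer_ne_zero),
    canonicalAbs_uniformizer_zpow, zpow_cpow Nat.card_pos, rootTerm, mul_add,
    Complex.cpow_add _ _ hq, Complex.real_smul]
  have h2 : (Nat.card 𝓀[K] : ℂ) ^ ((m : ℂ) * N) = (((Nat.card 𝓀[K] : ℝ) ^ m) ^ N : ℝ) := by
    rw [mul_comm, Complex.cpow_nat_mul, Complex.cpow_intCast]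
    push_cast
    rfl
  rw [h2]
  ring

theorem integrableOn_shell (hN : 0 < N) (ρ : ℝ → ℂ) {s : Fin N → Fin N → ℂ}
    (hi : Integrable (interaction (K := K) s (pairs univ)) (cubeMeasure K N)) (m : ℤ) :
    IntegrableOn (fun x => ρ (maxNorm x) * interaction s (pairs univ) x) (shell K N m)
      (productHaar K N) := by
  have hq : (0 : ℝ) < Nat.card 𝓀[K] := by exact_mod_cast Nat.card_pos (α := 𝓀[K])
  rw [IntegrableOn, restrict_shell hN]
  refine Integrable.smul_measure ?_ (ENNReal.pow_ne_top ENNReal.ofReal_ne_top)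
  rw [integrable_map_equiv]
  have h1 : Integrable (fun x => (((Nat.card 𝓀[K] : ℝ) ^ m) ^ N : ℝ)⁻¹ •
      (rootTerm (Nat.card 𝓀[K]) ρ (N + ∑ p ∈ pairs univ, s p.1 p.2) m *
        interaction (K := K) s (pairs univ) x)) ((cubeMeasure K N).restrict (shell K N 0)) :=
    ((hi.restrict).const_mul _).fun_smul (((Nat.card 𝓀[K] : ℝ) ^ m) ^ N : ℝ)⁻¹
  refine h1.congr ?_
  filter_upwards [ae_restrict_mem (measurableSet_shell hN 0)] with x hx
  rw [← density_shell m hx, inv_smul_smul₀ (by positivity)]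
  rfl

theorem setIntegral_shell (hN : 0 < N) (ρ : ℝ → ℂ) (s : Fin N → Fin N → ℂ) (m : ℤ) :
    ∫ x in shell K N m, ρ (maxNorm x) * interaction s (pairs univ) x ∂(productHaar K N) =
      rootTerm (Nat.card 𝓀[K]) ρ (N + ∑ p ∈ pairs univ, s p.1 p.2) m *
        ∫ x in shell K N 0, interaction s (pairs univ) x ∂(cubeMeasure K N) := by
  have hq : (0 : ℝ) < Nat.card 𝓀[K] := by exact_mod_cast Nat.card_pos (α := 𝓀[K])
  rw [restrict_shell hN, integral_smul_measure, integral_map_equiv, ← integral_const_mul,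
    ENNReal.toReal_pow, ENNReal.toReal_ofReal (zpow_pos hq m).le, ← integral_smul]
  refine setIntegral_congr_fun (measurableSet_shell hN 0) fun x hx => density_shell m hx

theorem setIntegral_norm_shell (hN : 0 < N) (ρ : ℝ → ℂ) (s : Fin N → Fin N → ℂ) (m : ℤ) :
    ∫ x in shell K N m, ‖ρ (maxNorm x) * interaction s (pairs univ) x‖ ∂(productHaar K N) =
      ‖rootTerm (Nat.card 𝓀[K]) ρ (N + ∑ p ∈ pairs univ, s p.1 p.2) m‖ *
        ∫ x in shell K N 0, ‖interaction s (pairs univ) x‖ ∂(cubeMeasure K N) := by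
  have hq : (0 : ℝ) < Nat.card 𝓀[K] := by exact_mod_cast Nat.card_pos (α := 𝓀[K])
  rw [restrict_shell hN, integral_smul_measure, integral_map_equiv, ← integral_const_mul,
    ENNReal.toReal_pow, ENNReal.toReal_ofReal (zpow_pos hq m).le, ← integral_smul]
  refine setIntegral_congr_fun (measurableSet_shell hN 0) fun x hx => ?_
  have h := congrArg norm (density_shell (ρ := ρ) (s := s) m hx)
  rw [norm_mul, norm_smul, Real.norm_of_nonneg (by positivity)] at h
  exact h

theorem setIntegral_shell_zero (hN : 0 < N) {s : Fin N → Fin N → ℂ}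
    (hi : Integrable (interaction (K := K) s (pairs univ)) (cubeMeasure K N)) :
    ∫ x in shell K N 0, interaction s (pairs univ) x ∂(cubeMeasure K N) =
      (1 - (Nat.card 𝓀[K] : ℂ) ^ (-(N + ∑ p ∈ pairs univ, s p.1 p.2))) *
        ∫ x, interaction (K := K) s (pairs univ) x ∂(cubeMeasure K N) := by
  classical
  have := Fintype.ofFinite 𝓀[K]
  have h1 := integral_residueUnion_add ({0} : Finset (Fin N → 𝓀[K])) hi
  have h0 : (0 : Fin N → 𝓀[K]) ∈ constantOn K (univ : Finset (Fin N)) := by simp [constantOn]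
  have h2 : ∫ x in residueUnion ((({0} : Finset (Fin N → 𝓀[K]))) : Set (Fin N → 𝓀[K])),
      interaction s (pairs univ) x ∂(cubeMeasure K N) =
      (Nat.card 𝓀[K] : ℂ) ^ (-(N + ∑ p ∈ pairs univ, s p.1 p.2)) *
        ∫ x, interaction (K := K) s (pairs univ) x ∂(cubeMeasure K N) := by
    rw [setIntegral_residueUnion _ _ hi, sum_singleton]
    simp only [← blockPairs_isolate (univ : Finset (Fin N))]
    rw [integral_interaction_lift, refineBy_isolate h0, neg_add,
      Complex.cpow_add _ _ (natCast_card_ne_zero K), Complex.cpow_neg _ (N : ℂ),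
      Complex.cpow_natCast, inv_pow, mul_assoc]
  rw [h2, ← shell_zero hN, ← eq_sub_iff_add_eq'] at h1
  rw [h1]; ring

theorem integrable_density (hN : 0 < N) {ρ : ℝ → ℂ} (hρ : HasAdmissibleGrowth ρ)
    {s : Fin N → Fin N → ℂ}
    (hi : Integrable (interaction (K := K) s (pairs univ)) (cubeMeasure K N))
    (hz : 1 < (N + ∑ p ∈ pairs (univ : Finset (Fin N)), s p.1 p.2 : ℂ).re) :
    Integrable (fun x : Fin N → K => ρ (maxNorm x) * interaction s (pairs univ) x)
      (productHaar K N) := by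
  rw [← Measure.restrict_eq_self_of_ae_mem (iUnion_shell_ae (K := K) hN)]
  refine integrableOn_iUnion_of_summable_integral_norm (integrableOn_shell hN ρ hi) ?_
  simp only [setIntegral_norm_shell hN]
  exact (summable_rootTerm hρ (one_lt_card_residue K) hz).norm.mul_right _

theorem integral_density (hN : 0 < N) {ρ : ℝ → ℂ} (hρ : HasAdmissibleGrowth ρ)
    {s : Fin N → Fin N → ℂ}
    (hi : Integrable (interaction (K := K) s (pairs univ)) (cubeMeasure K N))
    (hz : 1 < (N + ∑ p ∈ pairs (univ : Finset (Fin N)), s p.1 p.2 : ℂ).re) :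
    ∫ x : Fin N → K, ρ (maxNorm x) * interaction s (pairs univ) x ∂(productHaar K N) =
      (∑' m, rootTerm (Nat.card 𝓀[K]) ρ (N + ∑ p ∈ pairs univ, s p.1 p.2) m) *
        ((1 - (Nat.card 𝓀[K] : ℂ) ^ (-(N + ∑ p ∈ pairs univ, s p.1 p.2))) *
          ∫ x, interaction (K := K) s (pairs univ) x ∂(cubeMeasure K N)) := by
  have h := integrable_density hN hρ hi hz
  have h1 := hasSum_integral_iUnion (fun m => measurableSet_shell (K := K) hN m)
    pairwise_disjoint_shell h.integrableOn
  rw [Measure.restrict_eq_self_of_ae_mem (iUnion_shell_ae (K := K) hN)] at h1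
  rw [← h1.tsum_eq, ← setIntegral_shell_zero hN hi, ← tsum_mul_right]
  exact tsum_congr fun m => setIntegral_shell hN ρ s m

end Shells

section Caterpillar

variable {N : ℕ}

theorem mem_isolate_parts {C A : Finset (Fin N)} :
    A ∈ (isolate C).parts ↔ (A = C ∧ C.Nonempty) ∨ ∃ i ∉ C, A = {i} := by
  have hpart : ∀ i, (i ∈ C → (isolate C).part i = C) ∧ (i ∉ C → (isolate C).part i = {i}) := by
    intro i
    constructor <;> intro hi <;> ext j <;> rw [← part_eq_part_iff, isolate_part]
    · exact ⟨fun h => h.elim (fun h => h ▸ hi) fun h => h.2, fun h => .inr ⟨hi, h⟩⟩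
    · rw [mem_singleton]
      exact ⟨fun h => h.elim Eq.symm fun h => absurd h.1 hi, fun h => .inl h.symm⟩
  constructor
  · intro hA
    obtain ⟨i, hi⟩ := Finpartition.nonempty_of_mem_parts _ hA
    rw [← Finpartition.part_eq_of_mem _ hA hi]
    by_cases hC : i ∈ C
    · exact .inl ⟨(hpart i).1 hC, i, hC⟩
    · exact .inr ⟨i, hC, (hpart i).2 hC⟩
  · rintro (⟨rfl, i, hi⟩ | ⟨i, hi, rfl⟩)
    · have := (isolate A).part_mem.2 (mem_univ i)
      rwa [(hpart i).1 hi] at this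
    · have := (isolate C).part_mem.2 (mem_univ i)
      rwa [(hpart i).2 hi] at this

theorem eq_of_mem_isolate_parts {C A : Finset (Fin N)} (hA : A ∈ (isolate C).parts)
    (h : 1 < #A) : A = C := by
  rcases mem_isolate_parts.1 hA with h' | ⟨i, -, rfl⟩
  · exact h'.1
  · simp at h

theorem isSplit_isolate {C C' : Finset (Fin N)} (h : C' ⊂ C) :
    IsSplit (isolate C) (isolate C') := by
  constructor
  · intro A hA
    rcases mem_isolate_parts.1 hA with ⟨rfl, hne⟩ | ⟨i, -, rfl⟩
    · exact ⟨C, mem_isolate_parts.2 (.inl ⟨rfl, hne.mono h.1⟩), h.1⟩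
    · exact ⟨(isolate C).part i, Finpartition.part_mem _ |>.2 (mem_univ i),
        singleton_subset_iff.2 ((isolate C).mem_part_self.2 (mem_univ i))⟩
  · intro B hB hB1 hB'
    have h1 := eq_of_mem_isolate_parts hB hB1
    have h2 := eq_of_mem_isolate_parts hB' hB1
    exact h.ne (h2.symm.trans h1)

/-- The points with one of the first `k` values of an enumeration. -/
def initialSet (e : Equiv.Perm (Fin N)) (k : ℕ) : Finset (Fin N) := {i | (e i : ℕ) < k}

theorem card_initialSet (e : Equiv.Perm (Fin N)) {k : ℕ} (hk : k ≤ N) : #(initialSet e k) = k := by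
  have h1 : initialSet e k = (univ.filter fun j : Fin N => (j : ℕ) < k).map e.symm.toEmbedding := by
    ext i
    simp [initialSet, mem_map_equiv]
  rw [h1, card_map]
  rw [Fin.card_filter_val_lt]
  omega

theorem initialSet_ssubset (e : Equiv.Perm (Fin N)) {k l : ℕ} (hkl : k < l) (hl : l ≤ N) :
    initialSet e k ⊂ initialSet e l := by
  refine Finset.ssubset_iff_subset_ne.2 ⟨fun i hi => ?_, fun h => ?_⟩
  · simp only [initialSet, mem_filter, mem_univ, true_and] at hi ⊢
    omega
  · have := congrArg card h
    rw [card_initialSet e (by omega), card_initialSet e hl] at this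
    omega

/-- The filtration that splits off one point at a time. -/
def caterpillar (hN : 2 ≤ N) (e : Equiv.Perm (Fin N)) : SplittingFiltration N where
  length := N - 1
  level l := isolate (initialSet e (N - l))
  level_zero := by
    have h : initialSet e (N - ((0 : Fin (N - 1 + 1)) : ℕ)) = univ := by
      ext i; simp [initialSet]
    rw [h]
    ext A
    rw [mem_isolate_parts, mem_singleton]
    constructor
    · rintro (h | ⟨i, hi, -⟩)
      · exact h.1
      · exact absurd (mem_univ i) hi
    · rintro rfl
      exact .inl ⟨rfl, ⟨0, by omega⟩, mem_univ _⟩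
  level_last := by
    rw [parts_eq_image_singleton_iff, eq_bot_iff_card_le_one]
    intro B hB
    by_contra hB1
    have h1 := eq_of_mem_isolate_parts hB (by omega)
    have h2 := card_initialSet e (k := N - (Fin.last (N - 1) : ℕ)) (by omega)
    rw [← h1, Fin.val_last] at h2
    omega
  strictAnti := by
    refine Fin.strictAnti_iff_succ_lt.2 fun l => ?_
    have hl := l.2
    refine (isSplit_isolate (initialSet_ssubset e (by simp; omega) (by omega))).lt ?_
    rw [ne_eq, eq_bot_iff_card_le_one]
    intro h
    have hc := card_initialSet e (k := N - (l.castSucc : ℕ)) (by omega)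
    have h2 := h (initialSet e (N - (l.castSucc : ℕ)))
      (mem_isolate_parts.2 (.inl ⟨rfl, card_pos.1 (by rw [hc]; simp; omega)⟩))
    rw [hc, Fin.val_castSucc] at h2
    omega

theorem caterpillar_isReduced (hN : 2 ≤ N) (e : Equiv.Perm (Fin N)) :
    (caterpillar hN e).IsReduced := by
  rw [SplittingFiltration.isReduced_iff]
  intro l
  have hl : (l : ℕ) < N - 1 := l.2
  exact isSplit_isolate (initialSet_ssubset e (by simp; omega) (by omega))

theorem caterpillar_multiplicity_pos (hN : 2 ≤ N) (e : Equiv.Perm (Fin N)) {q : ℕ} (hq : 1 < q) :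
    0 < (caterpillar hN e).multiplicity q := by
  refine prod_pos fun B hB => ?_
  obtain ⟨-, hB1, l, hl⟩ := mem_filter.1 hB
  have hlN : (l : ℕ) < N - 1 := l.2
  rw [(caterpillar_isReduced hN e).degree_eq hB1 hl]
  have h1 : B = initialSet e (N - (l.castSucc : ℕ)) := eq_of_mem_isolate_parts hl hB1
  set C := initialSet e (N - (l.succ : ℕ)) with hC
  have h2 : (((caterpillar hN e).level l.succ).parts.filter fun A => A ⊆ B) ⊆
      insert C ((B \ C).image fun i => {i}) := by
    intro A hA
    obtain ⟨hA, hAB⟩ := mem_filter.1 hA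
    rcases mem_isolate_parts.1 hA with h | ⟨i, hi, rfl⟩
    · exact mem_insert.2 (.inl h.1)
    · exact mem_insert.2 (.inr (mem_image.2 ⟨i, mem_sdiff.2 ⟨singleton_subset_iff.1 hAB, hi⟩, rfl⟩))
  have h3 := (card_le_card h2).trans ((card_insert_le _ _).trans
    (Nat.add_le_add_right card_image_le 1))
  have h4 : #(B \ C) = 1 := by
    rw [card_sdiff_of_subset, h1, hC, card_initialSet e (by omega), card_initialSet e (by omega),
      Fin.val_castSucc, Fin.val_succ]
    · omega
    · rw [h1]
      exact (initialSet_ssubset e (by simp; omega) (by omega)).1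
  refine Nat.pos_of_ne_zero fun h => ?_
  rw [Nat.descFactorial_eq_zero_iff_lt] at h
  omega

theorem exists_admissible_mem_branches (hN : 2 ≤ N) {q : ℕ} (hq : 1 < q) {B : Finset (Fin N)}
    (hB : 1 < #B) : ∃ S ∈ admissible N q, B ∈ S.branches := by
  have hBN : #B ≤ N := by simpa using card_le_univ B
  have hcard : Fintype.card {i // i ∈ B} = Fintype.card {j : Fin N // (j : ℕ) < #B} := by
    rw [Fintype.card_coe, Fintype.card_subtype, Fin.card_filter_val_lt]
    omega
  let e := (Fintype.equivOfCardEq hcard).extendSubtype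
  have he : B = initialSet e #B := by
    ext i
    simp only [initialSet, mem_filter, mem_univ, true_and]
    refine ⟨fun hi => Equiv.extendSubtype_mem (Fintype.equivOfCardEq hcard) i hi, fun h => ?_⟩
    by_contra hi
    exact Equiv.extendSubtype_not_mem (Fintype.equivOfCardEq hcard) i hi h
  refine ⟨caterpillar hN e, mem_filter.2 ⟨mem_univ _, caterpillar_isReduced hN e,
    caterpillar_multiplicity_pos hN e hq⟩, mem_filter.2 ⟨mem_univ _, hB,
    (⟨N - #B, by change _ < N - 1; omega⟩ : Fin (N - 1)), ?_⟩⟩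
  have : N - (N - #B) = #B := by omega
  change B ∈ (isolate (initialSet e (N - (N - #B)))).parts
  rw [this, ← he]
  exact mem_isolate_parts.2 (.inl ⟨rfl, card_pos.1 (by omega)⟩)

theorem branchExponent_re_pos (hN : 2 ≤ N) {q : ℕ} (hq : 1 < q) {charge : Fin N → ℝ}
    (hc : ∀ i, 0 < charge i) {β : ℂ} (hβ : mehtaAbscissa q charge < β.re) {B : Finset (Fin N)}
    (hB : 1 < #B) :
    0 < (branchExponent B fun i j => ((charge i * charge j : ℝ) : ℂ) * β).re := by
  obtain ⟨S, hS, hBS⟩ := exists_admissible_mem_branches hN hq hB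
  have h1 : (⨅ S : {S : SplittingFiltration N // S ∈ admissible N q},
      ⨅ B : {B : Finset (Fin N) // B ∈ S.1.branches},
      ((#B.1 : ℝ) - 1) / ∑ p ∈ pairs B.1, charge p.1 * charge p.2) ≤
      ((#B : ℝ) - 1) / ∑ p ∈ pairs B, charge p.1 * charge p.2 :=
    (ciInf_le (Set.finite_range _).bddBelow ⟨S, hS⟩).trans
      (ciInf_le (f := fun B : {B : Finset (Fin N) // B ∈ S.branches} =>
        ((#B.1 : ℝ) - 1) / ∑ p ∈ pairs B.1, charge p.1 * charge p.2)
        (Set.finite_range _).bddBelow ⟨B, hBS⟩)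
  have hsum : 0 < ∑ p ∈ pairs B, charge p.1 * charge p.2 := by
    refine sum_pos (fun p _ => mul_pos (hc _) (hc _)) ?_
    obtain ⟨i, hi, j, hj, hij⟩ := one_lt_card.1 hB
    rcases lt_or_gt_of_ne hij with h | h
    · exact ⟨(i, j), mem_pairs.2 ⟨⟨hi, hj⟩, h⟩⟩
    · exact ⟨(j, i), mem_pairs.2 ⟨⟨hj, hi⟩, h⟩⟩
  rw [mehtaAbscissa] at hβ
  have h2 : -(((#B : ℝ) - 1) / ∑ p ∈ pairs B, charge p.1 * charge p.2) < β.re := by linarith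
  rw [← neg_div, div_lt_iff₀ hsum] at h2
  have h3 : (branchExponent B fun i j => ((charge i * charge j : ℝ) : ℂ) * β).re =
      ((#B : ℝ) - 1) + β.re * ∑ p ∈ pairs B, charge p.1 * charge p.2 := by
    rw [branchExponent, Complex.add_re, Complex.re_sum, mul_sum]
    simp only [Complex.re_ofReal_mul, Complex.sub_re, Complex.natCast_re, Complex.one_re]
    congr 1
    exact sum_congr rfl fun p _ => mul_comm _ _
  rw [h3]
  linarith

end Caterpillar

section Main

variable {K : Type*} [Field K] [ValuativeRel K] [TopologicalSpace K]
  [IsNonarchimedeanLocalField K] [MeasurableSpace K] [BorelSpace K] {N : ℕ}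

theorem gasDensity_eq (ρ : ℝ → ℂ) (charge : Fin N → ℝ) (β : ℂ) :
    gasDensity (K := K) ρ charge β = fun x => ρ (maxNorm x) *
      interaction (fun i j => ((charge i * charge j : ℝ) : ℂ) * β) (pairs univ) x := rfl

theorem partitionFunction_eq (hN : 2 ≤ N) {ρ : ℝ → ℂ} (hρ : HasAdmissibleGrowth ρ)
    {charge : Fin N → ℝ} (hc : ∀ i, 0 < charge i) {β : ℂ}
    (hs : ∀ B : Finset (Fin N), 1 < #B →
      0 < (branchExponent B fun i j => ((charge i * charge j : ℝ) : ℂ) * β).re) :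
    Integrable (gasDensity (K := K) ρ charge β) (productHaar K N) ∧
      Summable (rootTerm (Nat.card 𝓀[K]) ρ
        (N + ∑ p ∈ pairs (univ : Finset (Fin N)), ((charge p.1 * charge p.2 : ℝ) : ℂ) * β)) ∧
      partitionFunction K ρ charge β =
        rootFunction (Nat.card 𝓀[K]) ρ
            (N + ∑ p ∈ pairs (univ : Finset (Fin N)), ((charge p.1 * charge p.2 : ℝ) : ℂ) * β) *
          ∑ S ∈ admissible N (Nat.card 𝓀[K]), branchFunction S (Nat.card 𝓀[K])
            fun i j => ((charge i * charge j : ℝ) : ℂ) * β := by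
  set s : Fin N → Fin N → ℂ := fun i j => ((charge i * charge j : ℝ) : ℂ) * β with hsdef
  have hsign : (∀ i j, 0 ≤ (s i j).re) ∨ (∀ i j, (s i j).re ≤ 0) := by
    simp only [hsdef, Complex.re_ofReal_mul]
    rcases le_total 0 β.re with h | h
    · exact .inl fun i j => mul_nonneg (mul_pos (hc i) (hc j)).le h
    · exact .inr fun i j => mul_nonpos_of_nonneg_of_nonpos (mul_pos (hc i) (hc j)).le h
  have hi := integrable_interaction (K := K) hs hsign
  have hiu : Integrable (interaction (K := K) s (pairs univ)) (cubeMeasure K N) := by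
    have := hi (isolate univ)
    rwa [blockPairs_isolate] at this
  have hcu : #(univ : Finset (Fin N)) = N := by simp
  have he := hs univ (by omega)
  have hze : (N + ∑ p ∈ pairs (univ : Finset (Fin N)), s p.1 p.2 : ℂ) - 1 =
      branchExponent univ s := by
    rw [branchExponent, hcu]; ring
  have hz : 1 < (N + ∑ p ∈ pairs (univ : Finset (Fin N)), s p.1 p.2 : ℂ).re := by
    rw [← hze, Complex.sub_re, Complex.one_re] at he
    linarith
  have hq := one_lt_card_residue K
  have h0 := gasDensity_eq (K := K) ρ charge β
  rw [← hsdef] at h0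
  rw [partitionFunction, h0]
  change _ ∧ Summable (rootTerm _ _ (N + ∑ p ∈ pairs (univ : Finset (Fin N)), s p.1 p.2)) ∧
    _ = rootFunction _ _ (N + ∑ p ∈ pairs (univ : Finset (Fin N)), s p.1 p.2) * _
  clear_value s
  refine ⟨integrable_density (by omega) hρ hiu hz, summable_rootTerm hρ hq hz, ?_⟩
  have h1 := integral_density (K := K) (by omega) hρ hiu hz
  have h2 : (1 - (Nat.card 𝓀[K] : ℂ) ^ (-branchExponent univ s)) ≠ 0 := by
    have h3 := cpow_sub_one_ne_zero hq he
    intro h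
    apply h3
    rw [sub_eq_zero, Complex.cpow_neg] at h
    rw [inv_injective (h.symm.trans inv_one.symm), sub_self]
  rw [sum_branchFunction hN hs hi, rootFunction, hze]
  rw [h1, div_mul_eq_mul_div, div_mul_eq_mul_div, eq_div_iff h2]
  ring

end Main

section Orbits

variable {N : ℕ}

theorem image_mem_permPartition (σ : Equiv.Perm (Fin N))
    (P : Finpartition (univ : Finset (Fin N))) (B : Finset (Fin N)) :
    B.image σ ∈ (permPartition σ P).parts ↔ B ∈ P.parts := by
  rw [permPartition_parts, mem_image]
  constructor
  · rintro ⟨A, hA, h⟩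
    rwa [← image_injective σ.injective h]
  · exact fun h => ⟨B, h, rfl⟩

namespace SplittingFiltration

theorem image_mem_branches_smul (σ : Equiv.Perm (Fin N)) (S : SplittingFiltration N)
    (B : Finset (Fin N)) : B.image σ ∈ (σ • S).branches ↔ B ∈ S.branches := by
  simp only [branches, mem_filter, mem_univ, true_and, card_image_of_injective _ σ.injective]
  exact and_congr_right fun _ => exists_congr fun l => image_mem_permPartition σ _ B

theorem branches_smul (σ : Equiv.Perm (Fin N)) (S : SplittingFiltration N) :
    (σ • S).branches = S.branches.image fun B => B.image σ := by
  ext A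
  obtain ⟨B, rfl⟩ : ∃ B : Finset (Fin N), B.image σ = A :=
    ⟨A.image σ.symm, by rw [image_image]; simp⟩
  rw [image_mem_branches_smul, mem_image]
  constructor
  · exact fun h => ⟨B, h, rfl⟩
  · rintro ⟨B', hB', h⟩
    rwa [← image_injective σ.injective h]

theorem isReduced_smul (σ : Equiv.Perm (Fin N)) {S : SplittingFiltration N} (h : S.IsReduced) :
    (σ • S).IsReduced := by
  intro A hA
  rw [branches_smul, mem_image] at hA
  obtain ⟨B, hB, rfl⟩ := hA
  obtain ⟨l, hl, hu⟩ := h B hB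
  exact ⟨l, (image_mem_permPartition σ _ B).2 hl,
    fun l' hl' => hu l' ((image_mem_permPartition σ _ B).1 hl')⟩

theorem depth_smul (σ : Equiv.Perm (Fin N)) (S : SplittingFiltration N) (B : Finset (Fin N)) :
    (σ • S).depth (B.image σ) = S.depth B := by
  change (univ.filter fun l : Fin S.length =>
    B.image σ ∈ (permPartition σ (S.level l.castSucc)).parts).sup _ = _
  simp only [image_mem_permPartition]
  rfl

theorem degree_smul (σ : Equiv.Perm (Fin N)) (S : SplittingFiltration N) (B : Finset (Fin N)) :
    (σ • S).degree (B.image σ) = S.degree B := by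
  rw [degree, depth_smul]
  change #((permPartition σ (S.levelAt (S.depth B + 1))).parts.filter fun A => A ⊆ B.image σ) = _
  rw [permPartition_parts, filter_image, card_image_of_injective _ (image_injective σ.injective)]
  simp only [image_subset_image_iff σ.injective]
  rfl

theorem multiplicity_smul (σ : Equiv.Perm (Fin N)) (S : SplittingFiltration N) (q : ℕ) :
    (σ • S).multiplicity q = S.multiplicity q := by
  rw [multiplicity, branches_smul, prod_image (image_injective σ.injective).injOn]
  simp only [degree_smul]
  rfl

theorem prod_card_branches_smul (σ : Equiv.Perm (Fin N)) (S : SplittingFiltration N)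
    {M : Type*} [CommMonoid M] (h : ℕ → M) :
    ∏ B ∈ (σ • S).branches.erase univ, h #B = ∏ B ∈ S.branches.erase univ, h #B := by
  have : (σ • S).branches.erase univ = (S.branches.erase univ).image fun B => B.image σ := by
    have hu : (univ : Finset (Fin N)) = univ.image σ :=
      (image_univ_of_surjective σ.surjective).symm
    rw [branches_smul]
    conv_lhs => rw [hu]
    exact (Finset.image_erase (image_injective σ.injective) _ _).symm
  rw [this, prod_image (image_injective σ.injective).injOn]
  simp only [card_image_of_injective _ σ.injective]

end SplittingFiltration

theorem sum_eq_sum_transversal {C : Finset (SplittingFiltration N)} (hC : IsOrbitTransversal C)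
    (p : SplittingFiltration N → Prop) [DecidablePred p]
    (hp : ∀ (σ : Equiv.Perm (Fin N)) S, p S → p (σ • S))
    (f : SplittingFiltration N → ℂ) (hf : ∀ (σ : Equiv.Perm (Fin N)) S, f (σ • S) = f S) :
    ∑ S with p S, f S = ∑ S ∈ C with p S, (weight S : ℂ) * f S := by
  classical
  choose r hr hu using hC
  have hrp : ∀ S, p S → p (r S) := by
    intro S hS
    obtain ⟨σ, hσ⟩ := (hr S).2
    have hσ : σ • S = r S := hσ
    exact hσ ▸ hp σ S hS
  rw [← sum_fiberwise_of_maps_to (s := univ.filter p) (t := C.filter p) (g := r)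
    (fun S hS => mem_filter.2 ⟨(hr S).1, hrp S (mem_filter.1 hS).2⟩)]
  refine sum_congr rfl fun T hT => ?_
  obtain ⟨hTC, hTp⟩ := mem_filter.1 hT
  have h1 : ({S ∈ univ.filter p | r S = T} : Finset (SplittingFiltration N)) =
      (MulAction.orbit (Equiv.Perm (Fin N)) T).toFinset := by
    ext S
    simp only [mem_filter, mem_univ, true_and, Set.mem_toFinset]
    constructor
    · rintro ⟨-, rfl⟩
      exact MulAction.orbit_eq_iff.1 (MulAction.orbit_eq_iff.2 (hr S).2).symm
    · intro h
      refine ⟨?_, (hu S T ⟨hTC, MulAction.orbit_eq_iff.1 (MulAction.orbit_eq_iff.2 h).symm⟩).symm⟩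
      obtain ⟨σ, rfl⟩ := h
      exact hp σ T hTp
  rw [h1, weight, Set.ncard_eq_toFinset_card', ← nsmul_eq_mul]
  apply sum_eq_card_nsmul
  intro S hS
  rw [Set.mem_toFinset] at hS
  obtain ⟨σ, rfl⟩ := hS
  exact hf σ T

theorem card_pairs (B : Finset (Fin N)) : #(pairs B) = (#B).choose 2 := by
  have h1 : B.offDiag = pairs B ∪ (pairs B).map (Equiv.prodComm _ _).toEmbedding := by
    ext p
    simp only [mem_offDiag, mem_union, mem_pairs, mem_map_equiv, Equiv.prodComm_symm,
      Equiv.prodComm_apply, Prod.fst_swap, Prod.snd_swap]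
    constructor
    · rintro ⟨h1, h2, h3⟩
      rcases lt_or_gt_of_ne h3 with h | h
      · exact .inl ⟨⟨h1, h2⟩, h⟩
      · exact .inr ⟨⟨h2, h1⟩, h⟩
    · rintro (⟨⟨h1, h2⟩, h⟩ | ⟨⟨h1, h2⟩, h⟩)
      · exact ⟨h1, h2, h.ne⟩
      · exact ⟨h2, h1, h.ne'⟩
  have h2 : Disjoint (pairs B) ((pairs B).map (Equiv.prodComm _ _).toEmbedding) := by
    rw [disjoint_left]
    intro p hp hp'
    simp only [mem_map_equiv, Equiv.prodComm_symm, Equiv.prodComm_apply, mem_pairs, Prod.fst_swap,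
      Prod.snd_swap] at hp hp'
    exact lt_asymm hp.2 hp'.2
  have h3 := congrArg card h1
  rw [card_union_of_disjoint h2, card_map, offDiag_card, ← Nat.mul_sub_one] at h3
  rw [Nat.choose_two_right, h3]
  omega

theorem branchExponent_const {B : Finset (Fin N)} (hB : 0 < #B) (β : ℂ) :
    (branchExponent B fun _ _ => (((1 : ℝ) * 1 : ℝ) : ℂ) * β) =
      ((#B).choose 2 : ℂ) * (β + 2 / (#B : ℂ)) := by
  have hB' : (#B : ℂ) ≠ 0 := by exact_mod_cast hB.ne'
  rw [branchExponent, sum_const, card_pairs, nsmul_eq_mul, Nat.cast_choose_two]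
  push_cast
  field_simp
  ring

end Orbits

end PField

open PField
theorem mainTheorem2 (K : Type*) [Field K] [ValuativeRel K] [TopologicalSpace K]
    [IsNonarchimedeanLocalField K] [MeasurableSpace K] [BorelSpace K]
    (q : ℕ) (hq : Nat.card 𝓀[K] = q) (N : ℕ) (hN : 2 ≤ N)
    (ρ : ℝ → ℂ) (hρ : HasAdmissibleGrowth ρ) :
    (∀ charge : Fin N → ℝ, (∀ i, 0 < charge i) →
      ∀ β : ℂ, mehtaAbscissa q charge < β.re →
        Integrable (gasDensity (K := K) ρ charge β) (productHaar K N) ∧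
        Summable (rootTerm q ρ
          (N + ∑ p ∈ pairs (univ : Finset (Fin N)),
            ((charge p.1 * charge p.2 : ℝ) : ℂ) * β)) ∧
        partitionFunction K ρ charge β =
          rootFunction q ρ
              (N + ∑ p ∈ pairs (univ : Finset (Fin N)),
                ((charge p.1 * charge p.2 : ℝ) : ℂ) * β) *
            ∑ S ∈ admissible N q,
              branchFunction S q fun i j => ((charge i * charge j : ℝ) : ℂ) * β) ∧
    (∀ β : ℂ, -(2 / (N : ℝ)) < β.re →
      ∀ C : Finset (SplittingFiltration N), IsOrbitTransversal C →
        Integrable (gasDensity (K := K) ρ (fun _ : Fin N => 1) β) (productHaar K N) ∧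
        Summable (fun m : ℤ => ρ ((q : ℝ) ^ m) *
          (q : ℂ) ^ ((m : ℂ) * ((N.choose 2 : ℂ) * (β + 2 / ((N : ℂ) - 1))))) ∧
        partitionFunction K ρ (fun _ : Fin N => 1) β =
          (1 - (q : ℂ) ^ (-((N.choose 2 : ℂ) * (β + 2 / ((N : ℂ) - 1))))) /
              (1 - (q : ℂ) ^ (-((N.choose 2 : ℂ) * (β + 2 / (N : ℂ))))) *
            (∑' m : ℤ, ρ ((q : ℝ) ^ m) *
              (q : ℂ) ^ ((m : ℂ) * ((N.choose 2 : ℂ) * (β + 2 / ((N : ℂ) - 1))))) *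
            ∑ S ∈ C with S.IsReduced ∧ 0 < S.multiplicity q,
              ((weight S : ℂ) * (S.multiplicity q : ℂ) / (q : ℂ) ^ (N - 1)) *
                ∏ B ∈ S.branches.erase univ,
                  1 / ((q : ℂ) ^ (((#B).choose 2 : ℂ) * (β + 2 / (#B : ℂ))) - 1)) := by
  subst hq
  refine ⟨fun charge hc β hβ => partitionFunction_eq hN hρ hc fun B hB =>
    branchExponent_re_pos hN (one_lt_card_residue K) hc hβ hB, fun β hβ C hC => ?_⟩
  have hcu : #(univ : Finset (Fin N)) = N := by simp
  have hs : ∀ B : Finset (Fin N), 1 < #B →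
      0 < (branchExponent B fun _ _ => (((1 : ℝ) * 1 : ℝ) : ℂ) * β).re := by
    intro B hB
    have hBN : #B ≤ N := by simpa using card_le_univ B
    have h0 : (0 : ℝ) < #B := by exact_mod_cast (by omega : 0 < #B)
    have h1 : (2 : ℝ) / N ≤ 2 / #B := by
      apply div_le_div_of_nonneg_left (by norm_num) h0
      exact_mod_cast hBN
    have h2 : (β + 2 / (#B : ℂ)).re = β.re + 2 / #B := by
      have : (2 / (#B : ℂ)) = ((2 / #B : ℝ) : ℂ) := by push_cast; rfl
      rw [this, Complex.add_re, Complex.ofReal_re]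
    rw [branchExponent_const (by omega), ← Complex.ofReal_natCast, Complex.re_ofReal_mul, h2]
    have h3 : (0 : ℝ) < (#B).choose 2 := by exact_mod_cast Nat.choose_pos hB
    exact mul_pos h3 (by linarith)
  obtain ⟨h1, h2, h3⟩ := partitionFunction_eq (K := K) hN hρ (charge := fun _ => 1)
    (fun _ => one_pos) hs
  have hz : (N + ∑ p ∈ pairs (univ : Finset (Fin N)), (((1 : ℝ) * 1 : ℝ) : ℂ) * β : ℂ) =
      (N.choose 2 : ℂ) * (β + 2 / ((N : ℂ) - 1)) := by
    have hN1 : (N : ℂ) - 1 ≠ 0 := by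
      rw [sub_ne_zero]
      exact_mod_cast (by omega : N ≠ 1)
    rw [sum_const, card_pairs, hcu, nsmul_eq_mul, Nat.cast_choose_two]
    push_cast
    field_simp
    ring
  have hz1 : (N.choose 2 : ℂ) * (β + 2 / ((N : ℂ) - 1)) - 1 =
      (N.choose 2 : ℂ) * (β + 2 / (N : ℂ)) := by
    have := branchExponent_const (B := (univ : Finset (Fin N))) (by omega) β
    rw [hcu] at this
    rw [← hz, ← this, branchExponent, hcu]
    ring
  rw [hz] at h2 h3
  refine ⟨h1, h2, ?_⟩
  rw [h3, rootFunction, hz1]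
  congr 1
  have hf : ∀ S : SplittingFiltration N,
      branchFunction S (Nat.card 𝓀[K]) (fun _ _ => (((1 : ℝ) * 1 : ℝ) : ℂ) * β) =
      (S.multiplicity (Nat.card 𝓀[K]) : ℂ) / (Nat.card 𝓀[K] : ℂ) ^ (N - 1) *
        ∏ B ∈ S.branches.erase univ,
          1 / ((Nat.card 𝓀[K] : ℂ) ^ (((#B).choose 2 : ℂ) * (β + 2 / (#B : ℂ))) - 1) := by
    intro S
    rw [branchFunction]
    congr 1
    refine prod_congr rfl fun B hB => ?_
    have hB1 := (mem_filter.1 (mem_of_mem_erase hB)).2.1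
    rw [branchExponent_const (by omega)]
  rw [admissible, sum_congr rfl fun S _ => hf S, sum_eq_sum_transversal hC]
  · refine sum_congr rfl fun S _ => ?_
    rw [← mul_assoc, mul_div_assoc]
  · exact fun σ S h => ⟨SplittingFiltration.isReduced_smul σ h.1, by
      rw [SplittingFiltration.multiplicity_smul]; exact h.2⟩
  · intro σ S
    rw [SplittingFiltration.multiplicity_smul, SplittingFiltration.prod_card_branches_smul σ S
      (fun n => 1 / ((Nat.card 𝓀[K] : ℂ) ^ ((n.choose 2 : ℂ) * (β + 2 / (n : ℂ))) - 1))]
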